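/- Let $(T(t))_{t\ge 0}$ be a bounded $C_0$-semigroup on a complex Hilbert space $X$, with generator $A$, and let $\beta>0$. For $\gamma>0$ the domain $D((-A)^\gamma)$ of the fractional power $(-A)^\gamma$ is regarded as a normed space with the graph norm $\|x\|+\|(-A)^\gamma x\|$; the antidual of a normed space is the space of its bounded conjugate-linear functionals; and $\langle\cdot,\cdot\rangle_\beta$ denotes the antiduality pairing for $D((-A)^\beta)$, that is, $\langle\varphi,y\rangle_\beta=\varphi(y)$. The inner product $\langle\cdot,\cdot\rangle$ of $X$ is linear in its first argument. Then $D((-A)^{\beta+1})\subseteq D((-A)^\beta)\cap D(A)$ and $A$ maps $D((-A)^{\beta+1})$ into $D((-A)^\beta)$, and the following two conditions are equivalent: (i) $T(\cdot)x\in L^2(0,\infty;X)$ for all $x\in D((-A)^\beta)$; (ii) there exists a bounded linear operator $P$ from $D((-A)^\beta)$ into its antidual such that $\langle Px,x\rangle_\beta\ge 0$ for all $x\in D((-A)^\beta)$ and $$\langle PAx,y\rangle_\beta+\langle Px,Ay\rangle_\beta=-\langle x,y\rangle,\qquad x,y\in D((-A)^{\beta+1}).$$ Furthermore, the operator $P$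 in (ii) is unique and determined by $$\langle Px,y\rangle_\beta=\int_0^\infty\langle T(t)x,T(t)y\rangle\,\mathrm{d}t,\qquad x,y\in D((-A)^\beta),$$ where the integral converges absolutely. -/

import Mathlib

open Set Filter Topology MeasureTheory

noncomputable section

/-- A `C₀`-semigroup `(T(t))_{t ≥ 0}` of bounded linear operators on a complex Banach space.
The operators are indexed by `ℝ`, but only the values at `t ≥ 0` carry meaning, and only those
values are ever used. -/
structure C0Semigroup (X : Type*) [NormedAddCommGroup X] [NormedSpace ℂ X] where
  /-- the operator `T(t)` -/
  op : ℝ → X →L[ℂ] X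
  op_zero : op 0 = 1
  op_add : ∀ s t : ℝ, 0 ≤ s → 0 ≤ t → op (s + t) = op s * op t
  continuousOn_orbit : ∀ x : X, ContinuousOn (fun t => op t x) (Ici 0)

/-- A bounded `C₀`-semigroup: `sup_{t ≥ 0} ‖T(t)‖ < ∞`. -/
structure BoundedC0Semigroup (X : Type*) [NormedAddCommGroup X] [NormedSpace ℂ X]
    extends C0Semigroup X where
  bounded : ∃ M : ℝ, ∀ t : ℝ, 0 ≤ t → ‖op t‖ ≤ M

namespace C0Semigroup

variable {X : Type*} [NormedAddCommGroup X] [NormedSpace ℂ X] (T : C0Semigroup X)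

/-- The graph of the generator: all pairs `(x, y)` with `y = lim_{h → 0+} h⁻¹ (T(h) x - x)`. -/
def generatorGraph : Submodule ℂ (X × X) where
  carrier := {p | Tendsto (fun h : ℝ => h⁻¹ • (T.op h p.1 - p.1)) (𝓝[>] 0) (𝓝 p.2)}
  add_mem' := by
    intro p q hp hq
    refine (hp.add hq).congr fun h => ?_
    simp only [Prod.fst_add, map_add, ← smul_add]
    congr 1
    abel
  zero_mem' := by simp
  smul_mem' := by
    intro c p hp
    refine (hp.const_smul c).congr fun h => ?_
    simp only [Prod.smul_fst, map_smul, ← smul_sub]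
    rw [smul_comm]

/-- The generator `A` of the semigroup, with its domain `D(A)`. -/
def generator : X →ₗ.[ℂ] X := T.generatorGraph.toLinearPMap

theorem mem_generator_graph (x y : X) :
    (x, y) ∈ T.generator.graph ↔
      Tendsto (fun h : ℝ => h⁻¹ • (T.op h x - x)) (𝓝[>] 0) (𝓝 y) := by
  rw [generator, Submodule.toLinearPMap_graph_eq]
  · rfl
  · rintro ⟨x, y⟩ hp (rfl : x = 0)
    have hp' : Tendsto (fun h : ℝ => h⁻¹ • (T.op h (0 : X) - 0)) (𝓝[>] 0) (𝓝 y) := hp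
    simp only [map_zero, sub_zero, smul_zero] at hp'
    exact tendsto_nhds_unique hp' tendsto_const_nhds

end C0Semigroup

namespace BoundedC0Semigroup

variable {X : Type*} [NormedAddCommGroup X] [NormedSpace ℂ X] (T : BoundedC0Semigroup X)

/-- The negative fractional power `(ε - A)^{-β}`, for `β, ε > 0`, where `A` is the generator:
`(ε - A)^{-β} x = Γ(β)⁻¹ ∫_0^∞ t^{β-1} e^{-ε t} T(t) x dt`. -/
def negFracPow (β ε : ℝ) (x : X) : X :=
  ∫ t in Ioi (0 : ℝ), (t ^ (β - 1) * Real.exp (-(ε * t)) / Real.Gamma β) • T.op t x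

/-- The kernel of the integral above, extended by zero to the negative half-line. -/
def fracKernel (β ε : ℝ) : ℝ → ℝ :=
  (Ioi (0 : ℝ)).indicator fun t => t ^ (β - 1) * Real.exp (-(ε * t)) / Real.Gamma β

theorem integrable_fracKernel {β ε : ℝ} (hβ : 0 < β) (hε : 0 < ε) :
    Integrable (fracKernel β ε) := by
  rw [fracKernel, integrable_indicator_iff measurableSet_Ioi]
  have h := integrableOn_rpow_mul_exp_neg_mul_rpow (p := 1) (s := β - 1) (b := ε)
    (by linarith) one_pos hε
  refine IntegrableOn.congr_fun (h.div_const (Real.Gamma β)) (fun t _ => ?_) measurableSet_Ioi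
  simp [Real.rpow_one]

theorem fracKernel_conv {β γ : ℝ} (ε : ℝ) (hβ : 0 < β) (hγ : 0 < γ) (u : ℝ) :
    ∫ t, fracKernel β ε t * fracKernel γ ε (u - t) = fracKernel (β + γ) ε u := by
  have key : (fun t => fracKernel β ε t * fracKernel γ ε (u - t)) =
      (Ioo 0 u).indicator fun t => (Real.exp (-(ε * u)) / (Real.Gamma β * Real.Gamma γ)) *
        (t ^ (β - 1) * (u - t) ^ (γ - 1)) := by
    funext t
    by_cases ht : t ∈ Ioo 0 u
    · have h1 : t ∈ Ioi (0 : ℝ) := ht.1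
      have h2 : u - t ∈ Ioi (0 : ℝ) := sub_pos.2 ht.2
      rw [indicator_of_mem ht, fracKernel, fracKernel, indicator_of_mem h1, indicator_of_mem h2]
      have : Real.exp (-(ε * u)) = Real.exp (-(ε * t)) * Real.exp (-(ε * (u - t))) := by
        rw [← Real.exp_add]
        congr 1
        ring
      rw [this]
      ring
    · rw [indicator_of_notMem ht]
      by_cases h1 : 0 < t
      · have h2 : u - t ∉ Ioi (0 : ℝ) := fun h => ht ⟨h1, sub_pos.1 h⟩
        rw [fracKernel, fracKernel, indicator_of_notMem h2, mul_zero]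
      · have h1' : t ∉ Ioi (0 : ℝ) := h1
        rw [fracKernel, indicator_of_notMem h1', zero_mul]
  rw [key, integral_indicator measurableSet_Ioo]
  by_cases hu : 0 < u
  · have hu' : u ∈ Ioi (0 : ℝ) := hu
    rw [fracKernel, indicator_of_mem hu', integral_const_mul, ← integral_Ioc_eq_integral_Ioo,
      ← intervalIntegral.integral_of_le hu.le]
    have hB : ∫ t in (0 : ℝ)..u, t ^ (β - 1) * (u - t) ^ (γ - 1) =
        u ^ (β + γ - 1) * (Real.Gamma β * Real.Gamma γ / Real.Gamma (β + γ)) := by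
      have h := Complex.betaIntegral_scaled (β : ℂ) (γ : ℂ) hu
      rw [Complex.betaIntegral_eq_Gamma_mul_div _ _ (by simpa) (by simpa),
        ← Complex.ofReal_add, Complex.Gamma_ofReal, Complex.Gamma_ofReal,
        Complex.Gamma_ofReal] at h
      have h3 : ((∫ t in (0 : ℝ)..u, t ^ (β - 1) * (u - t) ^ (γ - 1) : ℝ) : ℂ) =
          ∫ x in (0 : ℝ)..u, (x : ℂ) ^ ((β : ℂ) - 1) * ((u : ℂ) - x) ^ ((γ : ℂ) - 1) := by
        rw [← intervalIntegral.integral_ofReal]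
        refine intervalIntegral.integral_congr fun x hx => ?_
        rw [uIcc_of_le hu.le] at hx
        have e1 := Complex.ofReal_cpow hx.1 (β - 1)
        have e2 := Complex.ofReal_cpow (sub_nonneg.2 hx.2) (γ - 1)
        push_cast at e1 e2 ⊢
        rw [e1, e2]
      have e3 := Complex.ofReal_cpow hu.le (β + γ - 1)
      rw [← h3] at h
      push_cast at e3 h
      rw [← e3] at h
      exact_mod_cast h
    rw [hB]
    have g1 := (Real.Gamma_pos_of_pos hβ).ne'
    have g2 := (Real.Gamma_pos_of_pos hγ).ne'
    have g3 := (Real.Gamma_pos_of_pos (add_pos hβ hγ)).ne'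
    field_simp
  · have hu' : u ∉ Ioi (0 : ℝ) := hu
    rw [fracKernel, indicator_of_notMem hu', Ioo_eq_empty hu]
    simp

/-- The orbit `T(·)x` on `(0,∞)`, extended by zero. -/
def orbitExt (x : X) : ℝ → X := (Ioi (0 : ℝ)).indicator fun t => T.op t x

theorem aestronglyMeasurable_orbitExt (x : X) : AEStronglyMeasurable (T.orbitExt x) volume := by
  rw [orbitExt, aestronglyMeasurable_indicator_iff measurableSet_Ioi]
  exact ((T.continuousOn_orbit x).mono Ioi_subset_Ici_self).aestronglyMeasurable measurableSet_Ioi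

theorem orbitExt_bounded (x : X) : ∃ C : ℝ, ∀ t, ‖T.orbitExt x t‖ ≤ C := by
  obtain ⟨M, hM⟩ := T.bounded
  refine ⟨M * ‖x‖, fun t => ?_⟩
  have hM0 : 0 ≤ M := (norm_nonneg _).trans (hM 0 le_rfl)
  by_cases ht : t ∈ Ioi (0 : ℝ)
  · rw [orbitExt, indicator_of_mem ht]
    exact (T.op t).le_of_opNorm_le (hM t (le_of_lt ht)) x
  · rw [orbitExt, indicator_of_notMem ht, norm_zero]
    positivity

theorem integrable_fracKernel_smul {β ε : ℝ} (hβ : 0 < β) (hε : 0 < ε) (x : X) :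
    Integrable fun t => fracKernel β ε t • T.orbitExt x t := by
  obtain ⟨C, hC⟩ := T.orbitExt_bounded x
  exact (integrable_fracKernel hβ hε).smul_bdd C (T.aestronglyMeasurable_orbitExt x)
    (Eventually.of_forall hC)

theorem negFracPow_eq (β ε : ℝ) (x : X) :
    T.negFracPow β ε x = ∫ t, fracKernel β ε t • T.orbitExt x t := by
  rw [negFracPow, ← integral_indicator measurableSet_Ioi]
  congr 1
  funext t
  by_cases ht : t ∈ Ioi (0 : ℝ)
  · simp only [fracKernel, orbitExt, indicator_of_mem ht]
  · simp only [fracKernel, orbitExt, indicator_of_notMem ht, zero_smul]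

theorem orbitExt_add (x y : X) (t : ℝ) :
    T.orbitExt (x + y) t = T.orbitExt x t + T.orbitExt y t := by
  by_cases ht : t ∈ Ioi (0 : ℝ)
  · simp only [orbitExt, indicator_of_mem ht, map_add]
  · simp only [orbitExt, indicator_of_notMem ht, add_zero]

theorem orbitExt_smul (c : ℂ) (x : X) (t : ℝ) :
    T.orbitExt (c • x) t = c • T.orbitExt x t := by
  by_cases ht : t ∈ Ioi (0 : ℝ)
  · simp only [orbitExt, indicator_of_mem ht, map_smul]
  · simp only [orbitExt, indicator_of_notMem ht, smul_zero]

theorem negFracPow_add {β ε : ℝ} (hβ : 0 < β) (hε : 0 < ε) (x y : X) :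
    T.negFracPow β ε (x + y) = T.negFracPow β ε x + T.negFracPow β ε y := by
  rw [negFracPow_eq, negFracPow_eq, negFracPow_eq,
    ← integral_add (T.integrable_fracKernel_smul hβ hε x) (T.integrable_fracKernel_smul hβ hε y)]
  simp only [orbitExt_add, smul_add]

theorem negFracPow_smul (β ε : ℝ) (c : ℂ) (x : X) :
    T.negFracPow β ε (c • x) = c • T.negFracPow β ε x := by
  rw [negFracPow_eq, negFracPow_eq, ← integral_smul]
  congr 1
  funext t
  rw [orbitExt_smul, smul_comm]

theorem negFracPow_zero (β ε : ℝ) : T.negFracPow β ε 0 = 0 := by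
  have := T.negFracPow_smul β ε 0 0
  simpa using this

/-- The orbit of `T(t) y` for `t ≥ 0` is a translate. -/
theorem op_orbitExt (x : X) {s t : ℝ} (hs : 0 < s) (ht : 0 < t) :
    T.orbitExt x (s + t) = T.op t (T.orbitExt x s) := by
  have h1 : s ∈ Ioi (0 : ℝ) := hs
  have h2 : s + t ∈ Ioi (0 : ℝ) := add_pos hs ht
  rw [orbitExt, indicator_of_mem h1, indicator_of_mem h2, add_comm, T.op_add t s ht.le hs.le]
  rfl

variable [CompleteSpace X]

/-- `(ε - A)^{-β} (ε - A)^{-γ} = (ε - A)^{-(β + γ)}`. -/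
theorem negFracPow_negFracPow {β γ ε : ℝ} (hβ : 0 < β) (hγ : 0 < γ) (hε : 0 < ε) (x : X) :
    T.negFracPow β ε (T.negFracPow γ ε x) = T.negFracPow (β + γ) ε x := by
  obtain ⟨C, hC⟩ := T.orbitExt_bounded x
  have hint : Integrable (fun p : ℝ × ℝ =>
      (fracKernel β ε p.2 * fracKernel γ ε (p.1 - p.2)) • T.orbitExt x p.1)
      (volume.prod volume) := by
    have hk : Integrable (fun p : ℝ × ℝ => fracKernel β ε p.2 * fracKernel γ ε (p.1 - p.2))
        (volume.prod volume) :=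
      (integrable_fracKernel hβ hε).convolution_integrand (ContinuousLinearMap.mul ℝ ℝ)
        (integrable_fracKernel hγ hε)
    exact hk.smul_bdd C (T.aestronglyMeasurable_orbitExt x).comp_fst
      (Eventually.of_forall fun p => hC p.1)
  have hswap := integral_integral_swap (μ := (volume : Measure ℝ)) (ν := (volume : Measure ℝ))
    (f := fun u t => (fracKernel β ε t * fracKernel γ ε (u - t)) • T.orbitExt x u) hint
  have hleft : ∀ u, ∫ t, (fracKernel β ε t * fracKernel γ ε (u - t)) • T.orbitExt x u =
      fracKernel (β + γ) ε u • T.orbitExt x u := fun u => by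
    rw [integral_smul_const, fracKernel_conv ε hβ hγ]
  have hright : ∀ t, ∫ u, (fracKernel β ε t * fracKernel γ ε (u - t)) • T.orbitExt x u =
      fracKernel β ε t • T.orbitExt (T.negFracPow γ ε x) t := fun t => by
    by_cases ht : t ∈ Ioi (0 : ℝ)
    · simp only [mul_smul]
      rw [integral_smul]
      congr 1
      have h1 := integral_sub_right_eq_self (μ := (volume : Measure ℝ))
        (fun s => fracKernel γ ε s • T.orbitExt x (s + t)) t
      simp only [sub_add_cancel] at h1
      have h2 : T.orbitExt (T.negFracPow γ ε x) t = T.op t (T.negFracPow γ ε x) :=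
        indicator_of_mem ht _
      rw [h1, h2, negFracPow_eq,
        ← ContinuousLinearMap.integral_comp_comm _ (T.integrable_fracKernel_smul hγ hε x)]
      congr 1
      funext s
      by_cases hs : s ∈ Ioi (0 : ℝ)
      · rw [T.op_orbitExt x hs ht, ContinuousLinearMap.map_smul_of_tower]
      · simp only [fracKernel, indicator_of_notMem hs, zero_smul, map_zero]
    · have : fracKernel β ε t = 0 := indicator_of_notMem ht _
      simp [this]
  rw [T.negFracPow_eq β, T.negFracPow_eq (β + γ)]
  simp only [hleft, hright] at hswap
  exact hswap.symm

/-- The resolvent `(ε - A)^{-1}` is injective. -/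
theorem eq_zero_of_negFracPow_one {ε : ℝ} (hε : 0 < ε) {x : X}
    (hx : T.negFracPow 1 ε x = 0) : x = 0 := by
  set f : ℝ → X := fun t => Real.exp (-(ε * t)) • T.op t x with hf
  have hec : ContinuousOn (fun t : ℝ => Real.exp (-(ε * t))) (Ici 0) := by fun_prop
  have hfc : ContinuousOn f (Ici 0) := hec.smul (T.continuousOn_orbit x)
  have hfi : IntegrableOn f (Ioi 0) := by
    have h := (T.integrable_fracKernel_smul one_pos hε x).integrableOn (s := Ioi 0)
    refine IntegrableOn.congr_fun h (fun t ht => ?_) measurableSet_Ioi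
    simp [fracKernel, orbitExt, indicator_of_mem ht, hf]
  have h0 : ∫ t in Ioi (0 : ℝ), f t = 0 := by
    rw [← hx, negFracPow]
    simp [hf]
  have htail : ∀ h : ℝ, 0 < h → ∫ t in Ioi h, f t = 0 := by
    intro h hh
    have e1 : ∫ t in Ioi (0 : ℝ), f (t + h) = ∫ t in Ioi h, f t := by
      rw [← integral_indicator measurableSet_Ioi, ← integral_indicator measurableSet_Ioi,
        ← integral_add_right_eq_self ((Ioi h).indicator f) h]
      congr 1
      funext t
      simp [indicator]
    rw [← e1]
    have e2 : ∀ t ∈ Ioi (0 : ℝ), f (t + h) = Real.exp (-(ε * h)) • T.op h (f t) := by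
      intro t ht
      simp only [hf]
      rw [add_comm, T.op_add h t hh.le (le_of_lt ht), ContinuousLinearMap.map_smul_of_tower,
        smul_smul, ← Real.exp_add, show -(ε * h) + -(ε * t) = -(ε * (h + t)) by ring]
      rfl
    rw [setIntegral_congr_fun measurableSet_Ioi e2, integral_smul,
      ContinuousLinearMap.integral_comp_comm _ hfi, h0, map_zero, smul_zero]
  have hzero : ∀ h ∈ Ioi (0 : ℝ), ∫ t in (0 : ℝ)..h, f t = 0 := by
    intro h hh
    have := intervalIntegral.integral_Ioi_sub_Ioi hfi (le_of_lt hh)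
    rw [h0, htail h hh, sub_zero] at this
    exact this.symm
  have hfii : IntervalIntegrable f volume 0 1 := by
    refine ContinuousOn.intervalIntegrable (hfc.mono ?_)
    rw [uIcc_of_le zero_le_one]
    exact Icc_subset_Ici_self
  have hd : HasDerivWithinAt (fun u => ∫ t in (0 : ℝ)..u, f t) (f 0) (Ici 0) 0 := by
    have hmeas : StronglyMeasurableAtFilter f (𝓝[>] 0) :=
      ⟨Ioi 0, self_mem_nhdsWithin, hfi.aestronglyMeasurable⟩
    have hcont : ContinuousWithinAt f (Ioi 0) 0 :=
      (hfc 0 self_mem_Ici).mono Ioi_subset_Ici_self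
    exact intervalIntegral.integral_hasDerivWithinAt_right
      (IntervalIntegrable.refl : IntervalIntegrable f volume 0 0) hmeas hcont
  have hd0 : HasDerivWithinAt (fun u => ∫ t in (0 : ℝ)..u, f t) (0 : X) (Ici 0) 0 := by
    refine (hasDerivWithinAt_const (0 : ℝ) (Ici 0) (0 : X)).congr (fun u hu => ?_) (by simp)
    rcases eq_or_lt_of_le (show (0 : ℝ) ≤ u from hu) with rfl | hu'
    · simp
    · exact hzero u hu'
  have := (uniqueDiffOn_Ici (0 : ℝ) 0 self_mem_Ici).eq_deriv _ hd hd0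
  simpa [hf, T.op_zero] using this

/-- `(ε - A)^{-β}` is injective. -/
theorem eq_zero_of_negFracPow {β ε : ℝ} (hβ : 0 < β) (hε : 0 < ε) {x : X}
    (hx : T.negFracPow β ε x = 0) : x = 0 := by
  have hnat : ∀ n : ℕ, ∀ x : X, T.negFracPow (n + 1) ε x = 0 → x = 0 := by
    intro n
    induction n with
    | zero =>
      intro x hx
      refine T.eq_zero_of_negFracPow_one hε ?_
      simpa using hx
    | succ n ih =>
      intro x hx
      refine T.eq_zero_of_negFracPow_one hε (ih _ ?_)
      rw [T.negFracPow_negFracPow (by positivity) one_pos hε]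
      exact_mod_cast hx
  obtain ⟨n, hn⟩ := exists_nat_gt β
  refine hnat n x ?_
  have h := T.negFracPow_negFracPow (β := n + 1 - β) (by linarith) hβ hε x
  rw [hx, T.negFracPow_zero, sub_add_cancel] at h
  exact h.symm

/-- The graph of the fractional power `(-A)^β`, `β > 0`, as the strong limit of `(ε - A)^β` as
`ε → 0+`: the pairs `(x, y)` such that `x` lies in the domain of `(ε - A)^β = ((ε - A)^{-β})⁻¹`,
that is, in the range of `(ε - A)^{-β}`, for all `ε > 0`, and `(ε - A)^β x → y`.
Here `z ε` is the value `(ε - A)^β x`. -/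
def fracPowGraph (β : ℝ) (hβ : 0 < β) : Submodule ℂ (X × X) where
  carrier := {p | ∃ z : ℝ → X, (∀ ε : ℝ, 0 < ε → T.negFracPow β ε (z ε) = p.1) ∧
    Tendsto z (𝓝[>] 0) (𝓝 p.2)}
  add_mem' := by
    rintro p q ⟨z, hz, hzl⟩ ⟨w, hw, hwl⟩
    refine ⟨fun ε => z ε + w ε, fun ε hε => ?_, hzl.add hwl⟩
    rw [T.negFracPow_add hβ hε, hz ε hε, hw ε hε]
    rfl
  zero_mem' := ⟨fun _ => 0, fun ε _ => T.negFracPow_zero β ε, tendsto_const_nhds⟩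
  smul_mem' := by
    rintro c p ⟨z, hz, hzl⟩
    refine ⟨fun ε => c • z ε, fun ε hε => ?_, hzl.const_smul c⟩
    rw [T.negFracPow_smul, hz ε hε]
    rfl

/-- The fractional power `(-A)^β`, `β > 0`, with its domain `D((-A)^β)`, where `A` is the
generator of a bounded `C₀`-semigroup. -/
def fracPow (β : ℝ) (hβ : 0 < β) : X →ₗ.[ℂ] X := (T.fracPowGraph β hβ).toLinearPMap

theorem mem_fracPow_graph (β : ℝ) (hβ : 0 < β) (x y : X) :
    (x, y) ∈ (T.fracPow β hβ).graph ↔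
      ∃ z : ℝ → X, (∀ ε : ℝ, 0 < ε → T.negFracPow β ε (z ε) = x) ∧
        Tendsto z (𝓝[>] 0) (𝓝 y) := by
  rw [fracPow, Submodule.toLinearPMap_graph_eq]
  · rfl
  · rintro ⟨x, y⟩ ⟨z, hz, hzl⟩ (rfl : x = 0)
    have h0 : z =ᶠ[𝓝[>] 0] fun _ => (0 : X) := by
      filter_upwards [self_mem_nhdsWithin] with ε hε
      exact T.eq_zero_of_negFracPow hβ hε (hz ε hε)
    exact tendsto_nhds_unique (hzl.congr' h0) tendsto_const_nhds

end BoundedC0Semigroup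

/-- The domain of an operator `B`, regarded as a normed space with respect to the graph norm
`‖x‖ + ‖B x‖` (see `GraphDomain.norm_def`). -/
def GraphDomain {X : Type*} [NormedAddCommGroup X] [NormedSpace ℂ X] (B : X →ₗ.[ℂ] X) : Type _ :=
  B.domain

namespace GraphDomain

variable {X : Type*} [NormedAddCommGroup X] [NormedSpace ℂ X] (B : X →ₗ.[ℂ] X)

instance : AddCommGroup (GraphDomain B) := inferInstanceAs (AddCommGroup B.domain)

instance : Module ℂ (GraphDomain B) := inferInstanceAs (Module ℂ B.domain)

/-- The inclusion of the domain in the ambient space. -/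
def incl : GraphDomain B →ₗ[ℂ] X := B.domain.subtype

/-- The operator as a map on its domain. -/
def apply : GraphDomain B →ₗ[ℂ] X := B.toFun

/-- The embedding `x ↦ (x, B x)` of the domain in `X × X` with the `ℓ¹` norm. -/
def embed : GraphDomain B →ₗ[ℂ] WithLp 1 (X × X) :=
  (WithLp.linearEquiv 1 ℂ (X × X)).symm.toLinearMap ∘ₗ (incl B).prod (apply B)

theorem embed_injective : Function.Injective (embed B) := by
  intro x y h
  have h1 : (incl B x, apply B x) = (incl B y, apply B y) :=
    (WithLp.linearEquiv 1 ℂ (X × X)).symm.injective h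
  exact Subtype.ext (Prod.ext_iff.1 h1).1

instance : NormedAddCommGroup (GraphDomain B) :=
  NormedAddCommGroup.induced _ _ (embed B) (embed_injective B)

instance : NormedSpace ℂ (GraphDomain B) := NormedSpace.induced ℂ _ _ (embed B)

theorem norm_def (x : GraphDomain B) : ‖x‖ = ‖incl B x‖ + ‖apply B x‖ :=
  WithLp.prod_norm_eq_of_L1 (embed B x)

end GraphDomain

/-- The antidual of a normed space: the space of bounded conjugate-linear functionals. -/
abbrev Antidual (E : Type*) [NormedAddCommGroup E] [NormedSpace ℂ E] : Type _ := E →L⋆[ℂ] ℂ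

namespace BoundedC0Semigroup

variable {X : Type*} [NormedAddCommGroup X] [InnerProductSpace ℂ X] [CompleteSpace X]
  (T : BoundedC0Semigroup X)

/-- `D((-A)^β)` with the graph norm. -/
abbrev FracDomain (β : ℝ) (hβ : 0 < β) : Type _ := GraphDomain (T.fracPow β hβ)

/-- The inclusion of `D((-A)^β)` in `X`. -/
abbrev fracIncl (β : ℝ) (hβ : 0 < β) : T.FracDomain β hβ →ₗ[ℂ] X :=
  GraphDomain.incl (T.fracPow β hβ)

/-- The Lyapunov equation `⟨P A x, y⟩_β + ⟨P x, A y⟩_β = -⟨x, y⟩` for `x, y ∈ D((-A)^{β+1})`,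
where the antiduality pairing is `⟨φ, y⟩_β = φ y`. The elements `x, y` of `D((-A)^{β+1})` and
`u = A x`, `v = A y` are taken as elements of `D((-A)^β)`. Inner products of the literature,
linear in the first argument, are written `⟨x, y⟩ = inner ℂ y x`. -/
def LyapunovEquation (β : ℝ) (hβ : 0 < β)
    (P : T.FracDomain β hβ →L[ℂ] Antidual (T.FracDomain β hβ)) : Prop :=
  ∀ x y u v : T.FracDomain β hβ,
    T.fracIncl β hβ x ∈ (T.fracPow (β + 1) (by positivity)).domain →
    T.fracIncl β hβ y ∈ (T.fracPow (β + 1) (by positivity)).domain →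
    (T.fracIncl β hβ x, T.fracIncl β hβ u) ∈ T.generator.graph →
    (T.fracIncl β hβ y, T.fracIncl β hβ v) ∈ T.generator.graph →
    P u y + P x v = - inner ℂ (T.fracIncl β hβ y) (T.fracIncl β hβ x)

/-- A bounded linear operator from `D((-A)^β)` into its antidual that is nonnegative and
satisfies the Lyapunov equation. -/
structure IsLyapunovOperator (β : ℝ) (hβ : 0 < β)
    (P : T.FracDomain β hβ →L[ℂ] Antidual (T.FracDomain β hβ)) : Prop where
  nonneg : ∀ x, 0 ≤ (P x x).re ∧ (P x x).im = 0
  equation : T.LyapunovEquation β hβ P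

end BoundedC0Semigroup

end

/-!
Write `A` for the generator and `R = (1 - A)⁻¹`, `J = (1 - A)^{-β}`. The whole statement is
transported from `D((-A)^β)` to `X` by means of `J`.

Let `Q = δ (δ - A)⁻¹`, a power-bounded operator. The kernel `t ^ (β - 1) e^{-εt} / Γ(β)` of
`(ε - A)^{-β}` expands in powers of `δ - ε`, which gives
`(ε - A)^{-β} = (δ - A)^{-β} (1 - (1 - ε/δ) Q)^{-β}` for `0 < ε < 2 δ` (`resPow_eq_mul_binPow`). The
coefficients of the binomial series of `(1 - s)^β` are absolutely summable up to `|s| = 1`, so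
`(1 - (1 - ε/δ) Q)^β` is a bounded operator that converges as `ε → 0`. Hence `D((-A)^β)` is the
range of `J`, and `(-A)^β J = (1 - R)^β` is bounded (`mem_fracPow_graph_iff`). A Bézout identity
`a J + b (1 - R)^β = 1` (`exists_bezout`) bounds `z` by the graph norm of `J z`; so `J` is an
isomorphism of `X` onto `D((-A)^β)` (`exists_equiv_graphDomain`). It maps `D(A) = R X` onto
`D((-A)^{β+1})` and commutes with `A` and with the semigroup.

An operator `P` as in the theorem thus becomes a bounded sesquilinear form `G` on `X` that satisfies
`G(Az, w) + G(z, Aw) = -⟨Jz, Jw⟩` on `D(A)` (`lyapunovEquation_iff`). Integration along orbits and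
density of `D(A)` give `∫₀ᵗ ⟨J T(s) z, J T(s) w⟩ ds = G(z, w) - G(T(t) z, T(t) w)` for all `z, w`
(`IsLyapunovForm.integral_eq`). If `G` is nonnegative, the orbits of vectors in the range of `J` are
therefore square integrable. By boundedness of the semigroup they tend to zero, and since the range
of `J` is dense, so do all orbits; letting `t → ∞` identifies `G` with the integral
(`IsLyapunovForm.eq_integral`). Conversely, if these orbits are square integrable, then
`z ↦ T(·) J z` is bounded into `L²` by the closed graph theorem, and the integral defines a solution
(`exists_isLyapunovForm`).
-/

/-! ### Binomial series of a power-bounded element -/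

/-- The Taylor coefficients of `(1 - s) ^ γ` at `s = 0`. -/
noncomputable def binCoeff (γ : ℝ) (k : ℕ) : ℝ := (-1) ^ k * Ring.choose γ k

theorem binCoeff_zero_right (γ : ℝ) : binCoeff γ 0 = 1 := by simp [binCoeff]

theorem binCoeff_succ (γ : ℝ) (k : ℕ) :
    (k + 1) * binCoeff γ (k + 1) = (k - γ) * binCoeff γ k := by
  have h := Ring.choose_smul_choose γ (Nat.le_succ k)
  simp only [Nat.succ_eq_add_one, Nat.choose_succ_self_right, add_tsub_cancel_left,
    Ring.choose_one_right, nsmul_eq_mul] at h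
  push_cast at h
  simp only [binCoeff, pow_succ]
  linear_combination (-(-1) ^ k) * h

/-- Vandermonde's identity, that is, `(1 - s) ^ γ * (1 - s) ^ δ = (1 - s) ^ (γ + δ)`. -/
theorem sum_antidiagonal_binCoeff (γ δ : ℝ) (n : ℕ) :
    ∑ p ∈ Finset.HasAntidiagonal.antidiagonal n, binCoeff γ p.1 * binCoeff δ p.2 =
      binCoeff (γ + δ) n := by
  rw [binCoeff, Ring.add_choose_eq n (Commute.all γ δ), Finset.mul_sum]
  refine Finset.sum_congr rfl fun p hp => ?_
  rw [← Finset.HasAntidiagonal.mem_antidiagonal.1 hp, binCoeff, binCoeff, pow_add]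
  ring

/-- The binomial series with exponent `γ > 0` converges absolutely at the boundary of the disc of
convergence: from some index on, `γ |c k|` is the telescoping difference
`k |c k| - (k + 1) |c (k + 1)|`. -/
theorem summable_abs_binCoeff {γ : ℝ} (hγ : 0 < γ) : Summable fun k => |binCoeff γ k| := by
  obtain ⟨N, hN⟩ := exists_nat_gt γ
  have hstep : ∀ k : ℕ, γ * |binCoeff γ (k + N)| =
      (k + N : ℕ) * |binCoeff γ (k + N)| - (k + 1 + N : ℕ) * |binCoeff γ (k + 1 + N)| := by
    intro k
    have h := congrArg abs (binCoeff_succ γ (k + N))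
    have h1 : (0 : ℝ) ≤ ((k + N : ℕ) : ℝ) + 1 := by positivity
    have h2 : (0 : ℝ) ≤ ((k + N : ℕ) : ℝ) - γ := by
      push_cast
      linarith [(k.cast_nonneg : (0 : ℝ) ≤ k)]
    rw [abs_mul, abs_mul, abs_of_nonneg h1, abs_of_nonneg h2,
      show k + N + 1 = k + 1 + N by ring] at h
    push_cast at h ⊢
    linarith
  have hs : Summable fun k => γ * |binCoeff γ (k + N)| := by
    refine summable_of_sum_range_le (c := N * |binCoeff γ N|) (fun k => by positivity)
      fun n => ?_
    rw [Finset.sum_congr rfl fun k _ => hstep k,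
      Finset.sum_range_sub' (fun k => ((k + N : ℕ) : ℝ) * |binCoeff γ (k + N)|)]
    simp only [zero_add]
    have : 0 ≤ ((n + N : ℕ) : ℝ) * |binCoeff γ (n + N)| := by positivity
    linarith
  exact (summable_nat_add_iff N).1 ((summable_mul_left_iff hγ.ne').1 hs)

theorem summable_abs_binCoeff_mul_pow (γ : ℝ) {r : ℝ} (hr : |r| < 1) :
    Summable fun k => |binCoeff γ k * r ^ k| := by
  obtain ⟨ρ, hrρ, hρ⟩ := exists_between hr
  have hlim : Tendsto (fun k : ℕ => |(k - γ) / ((k : ℝ) + 1)| * |r|) atTop (𝓝 (1 * |r|)) := by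
    refine Tendsto.mul_const _ ?_
    have h1 : Tendsto (fun k : ℕ => 1 - (1 + γ) * (1 / ((k : ℝ) + 1))) atTop
        (𝓝 (1 - (1 + γ) * 0)) :=
      tendsto_const_nhds.sub (tendsto_one_div_add_atTop_nhds_zero_nat.const_mul _)
    have h2 := h1.abs
    simp only [mul_zero, sub_zero, abs_one] at h2
    refine h2.congr fun k => ?_
    have : (k : ℝ) + 1 ≠ 0 := by positivity
    congr 1
    field_simp
    ring
  rw [one_mul] at hlim
  refine Summable.abs (summable_of_ratio_norm_eventually_le hρ ?_)
  filter_upwards [hlim.eventually_le_const hrρ] with k hk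
  have hk1 : (k : ℝ) + 1 ≠ 0 := by positivity
  have h : binCoeff γ (k + 1) = (k - γ) / (k + 1) * binCoeff γ k := by
    field_simp
    linear_combination binCoeff_succ γ k
  calc ‖binCoeff γ (k + 1) * r ^ (k + 1)‖
      = |(k - γ) / ((k : ℝ) + 1)| * |r| * ‖binCoeff γ k * r ^ k‖ := by
        rw [h, pow_succ, Real.norm_eq_abs, Real.norm_eq_abs, ← abs_mul, ← abs_mul]
        congr 1
        ring
    _ ≤ ρ * ‖binCoeff γ k * r ^ k‖ := by gcongr

/-- The coefficients of `(1 - r s) ^ γ` are absolutely summable. -/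
def BinSummable (γ r : ℝ) : Prop := Summable fun k => |binCoeff γ k * r ^ k|

theorem binSummable_of_abs_lt (γ : ℝ) {r : ℝ} (hr : |r| < 1) : BinSummable γ r :=
  summable_abs_binCoeff_mul_pow γ hr

theorem binSummable_one {γ : ℝ} (hγ : 0 < γ) : BinSummable γ 1 := by
  simpa [BinSummable] using summable_abs_binCoeff hγ

section BinPow

variable {𝔸 : Type*} [NormedRing 𝔸] [NormedAlgebra ℂ 𝔸]

/-- The binomial series `(1 - r Q) ^ γ = ∑ (-1)^k (γ choose k) r^k Q^k`. It is only meaningful if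
it converges, for example if `Q` is power-bounded and `BinSummable γ r`. -/
noncomputable def binPow (Q : 𝔸) (γ r : ℝ) : 𝔸 :=
  ∑' k : ℕ, ((binCoeff γ k * r ^ k : ℝ) : ℂ) • Q ^ k

variable {Q : 𝔸} {M : ℝ}

theorem norm_binPow_term_le (hQ : ∀ k, ‖Q ^ k‖ ≤ M) (γ r : ℝ) (k : ℕ) :
    ‖((binCoeff γ k * r ^ k : ℝ) : ℂ) • Q ^ k‖ ≤ |binCoeff γ k * r ^ k| * M := by
  rw [norm_smul, Complex.norm_real, Real.norm_eq_abs]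
  exact mul_le_mul_of_nonneg_left (hQ k) (abs_nonneg _)

theorem summable_norm_binPow_term (hQ : ∀ k, ‖Q ^ k‖ ≤ M) {γ r : ℝ} (h : BinSummable γ r) :
    Summable fun k => ‖((binCoeff γ k * r ^ k : ℝ) : ℂ) • Q ^ k‖ :=
  Summable.of_nonneg_of_le (fun _ => norm_nonneg _) (norm_binPow_term_le hQ γ r) (h.mul_right M)

theorem binPow_zero (Q : 𝔸) (r : ℝ) : binPow Q 0 r = 1 := by
  rw [binPow, tsum_eq_single 0]
  · simp [binCoeff]
  · intro k hk
    simp [binCoeff, Ring.choose_zero_pos ℝ (Nat.pos_of_ne_zero hk)]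

theorem binPow_one (Q : 𝔸) (r : ℝ) : binPow Q 1 r = 1 - (r : ℂ) • Q := by
  have hc : ∀ k, binCoeff 1 k = (-1) ^ k * (Nat.choose 1 k : ℝ) := fun k => by
    rw [binCoeff, ← Ring.choose_natCast, Nat.cast_one]
  rw [binPow, tsum_eq_sum (s := Finset.range 2)]
  · simp [Finset.sum_range_succ, hc, sub_eq_add_neg]
  · intro k hk
    have : 1 < k := by simpa using hk
    simp [hc, Nat.choose_eq_zero_of_lt this]

variable [CompleteSpace 𝔸]

theorem binPow_mul_binPow (hQ : ∀ k, ‖Q ^ k‖ ≤ M) {γ δ r : ℝ} (hγ : BinSummable γ r)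
    (hδ : BinSummable δ r) : binPow Q γ r * binPow Q δ r = binPow Q (γ + δ) r := by
  rw [binPow, binPow, tsum_mul_tsum_eq_tsum_sum_antidiagonal_of_summable_norm
    (summable_norm_binPow_term hQ hγ) (summable_norm_binPow_term hQ hδ)]
  refine tsum_congr fun n => ?_
  rw [← sum_antidiagonal_binCoeff, Finset.sum_mul, Complex.ofReal_sum, Finset.sum_smul]
  refine Finset.sum_congr rfl fun p hp => ?_
  rw [smul_mul_smul_comm, ← pow_add, Finset.HasAntidiagonal.mem_antidiagonal.1 hp,
    ← Complex.ofReal_mul,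
    ← Finset.HasAntidiagonal.mem_antidiagonal.1 hp, pow_add]
  congr 2
  ring

theorem binPow_natCast (hQ : ∀ k, ‖Q ^ k‖ ≤ M) (n : ℕ) :
    binPow Q (n + 1) 1 = (1 - Q) ^ (n + 1) := by
  induction n with
  | zero => simp [binPow_one]
  | succ n ih =>
    rw [pow_succ, ← ih, Nat.cast_succ,
      ← binPow_mul_binPow hQ (binSummable_one (by positivity)) (binSummable_one one_pos),
      binPow_one]
    simp

theorem tendsto_binPow_one (hQ : ∀ k, ‖Q ^ k‖ ≤ M) {γ : ℝ} (hγ : 0 < γ) :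
    Tendsto (fun ε : ℝ => binPow Q γ (1 - ε)) (𝓝[>] 0) (𝓝 (binPow Q γ 1)) := by
  have hM : 0 ≤ M := (norm_nonneg _).trans (hQ 0)
  refine tendsto_tsum_of_dominated_convergence ((summable_abs_binCoeff hγ).mul_right M)
    (fun k => ?_) ?_
  · have : Continuous fun ε : ℝ => ((binCoeff γ k * (1 - ε) ^ k : ℝ) : ℂ) • Q ^ k := by fun_prop
    have h := this.tendsto 0
    simp only [sub_zero] at h
    exact h.mono_left nhdsWithin_le_nhds
  · filter_upwards [Ioo_mem_nhdsGT (zero_lt_two' ℝ)] with ε hε k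
    refine (norm_binPow_term_le hQ γ _ k).trans ?_
    have : |(1 - ε) ^ k| ≤ 1 := by
      rw [abs_pow]
      exact pow_le_one₀ (abs_nonneg _) (abs_le.2 ⟨by linarith [hε.2], by linarith [hε.1]⟩)
    rw [abs_mul]
    gcongr
    exact mul_le_of_le_one_right (abs_nonneg _) this

end BinPow

/-! ### Negative fractional powers as bounded operators -/

/-- The Taylor coefficients of `(1 - s) ^ (-β)` are `Γ(β + j) / (j! Γ(β))`. -/
theorem binCoeff_neg_eq {β : ℝ} (hβ : 0 < β) (j : ℕ) :
    binCoeff (-β) j * (j.factorial * Real.Gamma β) = Real.Gamma (β + j) := by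
  induction j with
  | zero => simp [binCoeff_zero_right]
  | succ j ih =>
    have h1 : Real.Gamma (β + (j + 1 : ℕ)) = (β + j) * Real.Gamma (β + j) := by
      rw [← Real.Gamma_add_one (by positivity)]
      push_cast
      ring_nf
    rw [h1, ← ih, Nat.factorial_succ]
    push_cast
    linear_combination (j.factorial * Real.Gamma β) * binCoeff_succ (-β) j

namespace BoundedC0Semigroup

theorem fracKernel_nonneg {β : ℝ} (hβ : 0 < β) (ε t : ℝ) : 0 ≤ fracKernel β ε t := by
  refine indicator_nonneg (fun t (ht : 0 < t) => ?_) t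
  have := Real.Gamma_pos_of_pos hβ
  positivity

theorem integral_fracKernel {β ε : ℝ} (hβ : 0 < β) (hε : 0 < ε) :
    ∫ t, fracKernel β ε t = ε ^ (-β) := by
  rw [fracKernel, integral_indicator measurableSet_Ioi, integral_div,
    Real.integral_rpow_mul_exp_neg_mul_Ioi hβ hε, Real.rpow_neg hε.le, one_div,
    Real.inv_rpow hε.le]
  have := (Real.Gamma_pos_of_pos hβ).ne'
  field_simp

/-- Expansion of the kernel of `(ε - A)^{-β}` in powers of `δ - ε`. -/
theorem hasSum_fracKernel {β : ℝ} (hβ : 0 < β) (ε δ t : ℝ) :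
    HasSum (fun j : ℕ => binCoeff (-β) j * (δ - ε) ^ j * fracKernel (β + j) δ t)
      (fracKernel β ε t) := by
  by_cases ht : t ∈ Ioi (0 : ℝ)
  · have ht' : 0 < t := ht
    have h := (NormedSpace.expSeries_div_hasSum_exp ((δ - ε) * t)).mul_left (fracKernel β δ t)
    rw [← Real.exp_eq_exp_ℝ] at h
    have e1 : (fun j : ℕ => binCoeff (-β) j * (δ - ε) ^ j * fracKernel (β + j) δ t) =
        fun j : ℕ => fracKernel β δ t * (((δ - ε) * t) ^ j / j.factorial) := by
      funext j
      have hG := Real.Gamma_pos_of_pos hβ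
      have hGj : 0 < Real.Gamma (β + j) := Real.Gamma_pos_of_pos (by positivity)
      simp only [fracKernel, indicator_of_mem ht]
      rw [show β + j - 1 = β - 1 + j by ring, Real.rpow_add ht', Real.rpow_natCast, mul_pow]
      rw [← binCoeff_neg_eq hβ] at hGj ⊢
      have hf : (j.factorial : ℝ) ≠ 0 := by positivity
      have hb : binCoeff (-β) j ≠ 0 := fun h0 => by simp [h0] at hGj
      field_simp
    have e2 : fracKernel β ε t = fracKernel β δ t * Real.exp ((δ - ε) * t) := by
      simp only [fracKernel, indicator_of_mem ht]
      rw [show -(ε * t) = -(δ * t) + (δ - ε) * t by ring, Real.exp_add]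
      ring
    rwa [e1, e2]
  · simp only [fracKernel, indicator_of_notMem ht, mul_zero]
    exact hasSum_zero

variable {X : Type*} [NormedAddCommGroup X] [NormedSpace ℂ X] (T : BoundedC0Semigroup X)

theorem exists_one_le_bound : ∃ M : ℝ, 1 ≤ M ∧ ∀ t : ℝ, 0 ≤ t → ‖T.op t‖ ≤ M := by
  obtain ⟨M, hM⟩ := T.bounded
  exact ⟨max 1 M, le_max_left _ _, fun t ht => (hM t ht).trans (le_max_right _ _)⟩

/-- A bound of the semigroup that is at least `1`. -/
noncomputable def bd : ℝ := T.exists_one_le_bound.choose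

theorem one_le_bd : 1 ≤ T.bd := T.exists_one_le_bound.choose_spec.1

theorem bd_pos : 0 < T.bd := zero_lt_one.trans_le T.one_le_bd

theorem norm_op_le {t : ℝ} (ht : 0 ≤ t) : ‖T.op t‖ ≤ T.bd :=
  T.exists_one_le_bound.choose_spec.2 t ht

theorem norm_op_apply_le {t : ℝ} (ht : 0 ≤ t) (x : X) : ‖T.op t x‖ ≤ T.bd * ‖x‖ :=
  (T.op t).le_of_opNorm_le (T.norm_op_le ht) x

theorem norm_orbitExt_le (x : X) (t : ℝ) : ‖T.orbitExt x t‖ ≤ T.bd * ‖x‖ := by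
  by_cases ht : t ∈ Ioi (0 : ℝ)
  · rw [orbitExt, indicator_of_mem ht]
    exact T.norm_op_apply_le (le_of_lt ht) x
  · rw [orbitExt, indicator_of_notMem ht, norm_zero]
    exact mul_nonneg T.bd_pos.le (norm_nonneg _)

theorem norm_fracKernel_smul_le {β : ℝ} (hβ : 0 < β) (ε : ℝ) (x : X) (t : ℝ) :
    ‖fracKernel β ε t • T.orbitExt x t‖ ≤ fracKernel β ε t * (T.bd * ‖x‖) := by
  rw [norm_smul, Real.norm_of_nonneg (fracKernel_nonneg hβ ε t)]
  exact mul_le_mul_of_nonneg_left (T.norm_orbitExt_le x t) (fracKernel_nonneg hβ ε t)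

theorem integral_norm_fracKernel_smul_le {β ε : ℝ} (hβ : 0 < β) (hε : 0 < ε) (x : X) :
    ∫ t, ‖fracKernel β ε t • T.orbitExt x t‖ ≤ T.bd * ε ^ (-β) * ‖x‖ := by
  calc ∫ t, ‖fracKernel β ε t • T.orbitExt x t‖
      ≤ ∫ t, fracKernel β ε t * (T.bd * ‖x‖) :=
        integral_mono (T.integrable_fracKernel_smul hβ hε x).norm
          ((integrable_fracKernel hβ hε).mul_const _) (T.norm_fracKernel_smul_le hβ ε x)
    _ = T.bd * ε ^ (-β) * ‖x‖ := by
        rw [integral_mul_const, integral_fracKernel hβ hε]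
        ring

theorem norm_negFracPow_le {β ε : ℝ} (hβ : 0 < β) (hε : 0 < ε) (x : X) :
    ‖T.negFracPow β ε x‖ ≤ T.bd * ε ^ (-β) * ‖x‖ := by
  rw [negFracPow_eq]
  exact (norm_integral_le_integral_norm _).trans (T.integral_norm_fracKernel_smul_le hβ hε x)

open Classical in
/-- The negative fractional power `(ε - A)^{-β}` as a bounded operator; it is given the value `0`
unless `β` and `ε` are positive. -/
noncomputable def resPow (β ε : ℝ) : X →L[ℂ] X :=
  if h : 0 < β ∧ 0 < ε then
    LinearMap.mkContinuous
      { toFun := T.negFracPow β ε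
        map_add' := T.negFracPow_add h.1 h.2
        map_smul' := T.negFracPow_smul β ε }
      (T.bd * ε ^ (-β)) (T.norm_negFracPow_le h.1 h.2)
  else 0

theorem resPow_apply {β ε : ℝ} (hβ : 0 < β) (hε : 0 < ε) (x : X) :
    T.resPow β ε x = T.negFracPow β ε x := by
  rw [resPow, dif_pos ⟨hβ, hε⟩]
  rfl

theorem norm_resPow_le {β ε : ℝ} (hβ : 0 < β) (hε : 0 < ε) : ‖T.resPow β ε‖ ≤ T.bd * ε ^ (-β) := by
  have := T.bd_pos
  refine ContinuousLinearMap.opNorm_le_bound _ (by positivity) fun x => ?_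
  rw [T.resPow_apply hβ hε]
  exact T.norm_negFracPow_le hβ hε x

theorem op_comm {s t : ℝ} (hs : 0 ≤ s) (ht : 0 ≤ t) (x : X) :
    T.op s (T.op t x) = T.op t (T.op s x) := by
  have h := T.op_add s t hs ht
  rw [add_comm, T.op_add t s ht hs] at h
  exact (congrArg (fun S : X →L[ℂ] X => S x) h).symm

/-- An operator that commutes with the semigroup commutes with its generator. -/
theorem map_mem_generator_graph {S : X →L[ℂ] X}
    (hS : ∀ t : ℝ, 0 ≤ t → ∀ x, T.op t (S x) = S (T.op t x)) {x y : X}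
    (h : (x, y) ∈ T.generator.graph) : (S x, S y) ∈ T.generator.graph := by
  rw [T.mem_generator_graph] at h ⊢
  refine ((S.continuous.tendsto y).comp h).congr' ?_
  filter_upwards [self_mem_nhdsWithin] with t ht
  rw [hS t (le_of_lt ht), ← map_sub, Function.comp_apply, ContinuousLinearMap.map_smul_of_tower]

variable [CompleteSpace X]

theorem op_negFracPow {β ε t : ℝ} (hβ : 0 < β) (hε : 0 < ε) (ht : 0 ≤ t) (x : X) :
    T.op t (T.negFracPow β ε x) = T.negFracPow β ε (T.op t x) := by
  rw [negFracPow_eq, negFracPow_eq,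
    ← ContinuousLinearMap.integral_comp_comm _ (T.integrable_fracKernel_smul hβ hε x)]
  congr 1
  funext s
  by_cases hs : s ∈ Ioi (0 : ℝ)
  · simp only [orbitExt, indicator_of_mem hs]
    rw [ContinuousLinearMap.map_smul_of_tower, T.op_comm ht (le_of_lt hs)]
  · simp only [orbitExt, indicator_of_notMem hs, smul_zero, map_zero]

theorem op_resPow {t : ℝ} (ht : 0 ≤ t) (β ε : ℝ) (x : X) :
    T.op t (T.resPow β ε x) = T.resPow β ε (T.op t x) := by
  by_cases h : 0 < β ∧ 0 < ε
  · rw [T.resPow_apply h.1 h.2, T.resPow_apply h.1 h.2, T.op_negFracPow h.1 h.2 ht]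
  · simp [resPow, dif_neg h]

theorem resPow_mul_resPow {β γ ε : ℝ} (hβ : 0 < β) (hγ : 0 < γ) (hε : 0 < ε) :
    T.resPow β ε * T.resPow γ ε = T.resPow (β + γ) ε := by
  ext x
  rw [mul_apply_eq_comp, T.resPow_apply hβ hε, T.resPow_apply hγ hε,
    T.resPow_apply (add_pos hβ hγ) hε, T.negFracPow_negFracPow hβ hγ hε]

theorem resPow_injective {β ε : ℝ} (hβ : 0 < β) (hε : 0 < ε) :
    Function.Injective (T.resPow β ε) :=
  (injective_iff_map_eq_zero _).2 fun x hx =>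
    T.eq_zero_of_negFracPow hβ hε (by rwa [T.resPow_apply hβ hε] at hx)

/-- The power-bounded operator `δ (δ - A)⁻¹`. -/
noncomputable def scaledRes (δ : ℝ) : X →L[ℂ] X := (δ : ℂ) • T.resPow 1 δ

theorem resPow_mul_scaledRes_pow {β δ : ℝ} (hβ : 0 < β) (hδ : 0 < δ) (j : ℕ) :
    T.resPow β δ * T.scaledRes δ ^ j = ((δ ^ j : ℝ) : ℂ) • T.resPow (β + j) δ := by
  induction j with
  | zero => simp
  | succ j ih =>
    rw [pow_succ, ← mul_assoc, ih, scaledRes, smul_mul_smul_comm,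
      T.resPow_mul_resPow (by positivity) one_pos hδ]
    push_cast
    rw [pow_succ, add_assoc]

theorem norm_scaledRes_pow_le {δ : ℝ} (hδ : 0 < δ) (j : ℕ) : ‖T.scaledRes δ ^ j‖ ≤ T.bd := by
  cases j with
  | zero => exact ContinuousLinearMap.norm_id_le.trans T.one_le_bd
  | succ j =>
    have h : T.scaledRes δ ^ (j + 1) = ((δ ^ (j + 1) : ℝ) : ℂ) • T.resPow (1 + j) δ := by
      rw [pow_succ' (T.scaledRes δ), scaledRes, smul_mul_assoc, ← scaledRes,
        T.resPow_mul_scaledRes_pow one_pos hδ, smul_smul]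
      push_cast
      rw [pow_succ']
    rw [h, norm_smul, Complex.norm_real, Real.norm_of_nonneg (by positivity)]
    calc δ ^ (j + 1) * ‖T.resPow (1 + j) δ‖
        ≤ δ ^ (j + 1) * (T.bd * δ ^ (-(1 + j : ℝ))) := by
          gcongr
          exact T.norm_resPow_le (by positivity) hδ
      _ = T.bd := by
          rw [Real.rpow_neg hδ.le, show (1 + j : ℝ) = ((j + 1 : ℕ) : ℝ) by push_cast; ring,
            Real.rpow_natCast]
          field_simp

theorem abs_one_sub_div_lt {ε δ : ℝ} (hε : 0 < ε) (hεδ : ε < 2 * δ) : |1 - ε / δ| < 1 := by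
  have hδ : 0 < δ := by linarith
  have h1 : 0 < ε / δ := by positivity
  have h2 : ε / δ < 2 := by rwa [div_lt_iff₀ hδ]
  exact abs_lt.2 ⟨by linarith, by linarith⟩

/-- `(ε - A)^{-β} = (δ - A)^{-β} (1 - r Q)^{-β}` with `Q = δ (δ - A)⁻¹` and `r = 1 - ε / δ`. -/
theorem resPow_eq_mul_binPow {β ε δ : ℝ} (hβ : 0 < β) (hε : 0 < ε) (hεδ : ε < 2 * δ) :
    T.resPow β ε = T.resPow β δ * binPow (T.scaledRes δ) (-β) (1 - ε / δ) := by
  have hδ : 0 < δ := by linarith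
  set r := 1 - ε / δ with hr
  have hrδ : δ - ε = r * δ := by rw [hr]; field_simp
  have hsum : BinSummable (-β) r := binSummable_of_abs_lt _ (abs_one_sub_div_lt hε hεδ)
  ext x
  set F : ℕ → ℝ → X := fun j t =>
    (binCoeff (-β) j * (δ - ε) ^ j) • fracKernel (β + j) δ t • T.orbitExt x t with hF
  have hβj : ∀ j : ℕ, 0 < β + j := fun j => by positivity
  have hFint : ∀ j, Integrable (F j) := fun j =>
    (T.integrable_fracKernel_smul (hβj j) hδ x).smul _
  have hFnorm : ∀ j, ∫ t, ‖F j t‖ ≤ |binCoeff (-β) j * r ^ j| * (T.bd * δ ^ (-β) * ‖x‖) := by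
    intro j
    simp only [hF, norm_smul (binCoeff (-β) j * (δ - ε) ^ j)]
    rw [integral_const_mul, Real.norm_eq_abs]
    refine (mul_le_mul_of_nonneg_left (T.integral_norm_fracKernel_smul_le (hβj j) hδ x)
      (abs_nonneg _)).trans_eq ?_
    rw [hrδ, mul_pow, ← mul_assoc (binCoeff (-β) j), abs_mul _ (δ ^ j),
      abs_of_pos (by positivity : 0 < δ ^ j),
      neg_add, Real.rpow_add hδ, Real.rpow_neg hδ.le (j : ℝ), Real.rpow_natCast]
    field_simp
  have h1 := hasSum_integral_of_summable_integral_norm hFint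
    (Summable.of_nonneg_of_le (fun j => integral_nonneg fun t => norm_nonneg _) hFnorm
      (hsum.mul_right _))
  have h2 : ∀ t, ∑' j, F j t = fracKernel β ε t • T.orbitExt x t := by
    intro t
    have := (hasSum_fracKernel hβ ε δ t).smul_const (T.orbitExt x t)
    refine HasSum.tsum_eq ?_
    simpa only [hF, mul_smul] using this
  have h3 : ∀ j, ∫ t, F j t = (binCoeff (-β) j * (δ - ε) ^ j) • T.negFracPow (β + j) δ x := by
    intro j
    simp only [hF]
    rw [integral_smul, ← negFracPow_eq]
  simp only [h2, h3] at h1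
  rw [← negFracPow_eq] at h1
  have h4 : HasSum (fun j : ℕ => ((binCoeff (-β) j * r ^ j : ℝ) : ℂ) • T.scaledRes δ ^ j)
      (binPow (T.scaledRes δ) (-β) r) :=
    (summable_norm_binPow_term (T.norm_scaledRes_pow_le hδ) hsum).of_norm.hasSum
  have h5 := (ContinuousLinearMap.apply ℂ X x).hasSum (h4.mul_left (T.resPow β δ))
  have h6 : (fun j : ℕ => (binCoeff (-β) j * (δ - ε) ^ j) • T.negFracPow (β + j) δ x) =
      fun j : ℕ => ContinuousLinearMap.apply ℂ X x
        (T.resPow β δ * ((binCoeff (-β) j * r ^ j : ℝ) : ℂ) • T.scaledRes δ ^ j) := by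
    funext j
    rw [mul_smul_comm, T.resPow_mul_scaledRes_pow hβ hδ, smul_smul, ← Complex.ofReal_mul,
      ContinuousLinearMap.apply_apply, smul_apply, Complex.coe_smul,
      T.resPow_apply (hβj j) hδ, hrδ, mul_pow, mul_assoc]
  rw [T.resPow_apply hβ hε]
  rw [h6] at h1
  exact h1.unique h5

theorem resPow_mul_binPow {β ε δ : ℝ} (hβ : 0 < β) (hε : 0 < ε) (hεδ : ε < 2 * δ) :
    T.resPow β ε * binPow (T.scaledRes δ) β (1 - ε / δ) = T.resPow β δ := by
  have hδ : 0 < δ := by linarith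
  have hr := abs_one_sub_div_lt hε hεδ
  rw [T.resPow_eq_mul_binPow hβ hε hεδ, mul_assoc,
    binPow_mul_binPow (T.norm_scaledRes_pow_le hδ) (binSummable_of_abs_lt _ hr)
      (binSummable_of_abs_lt _ hr), neg_add_cancel, binPow_zero, mul_one]

theorem range_resPow_le_of_lt {β ε δ : ℝ} (hβ : 0 < β) (hε : 0 < ε) (hεδ : ε < 2 * δ) :
    range (T.resPow β δ) ⊆ range (T.resPow β ε) := by
  rintro _ ⟨z, rfl⟩
  refine ⟨binPow (T.scaledRes δ) β (1 - ε / δ) z, ?_⟩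
  rw [← T.resPow_mul_binPow hβ hε hεδ, mul_apply_eq_comp]

/-- The range of `(1 - A)^{-β}` is contained in that of every `(ε - A)^{-β}`. Only the steps from
`δ` to `ε < 2 δ` are given by a convergent binomial series; larger `ε` are reached by iteration. -/
theorem range_resPow_one_le {β ε : ℝ} (hβ : 0 < β) (hε : 0 < ε) :
    range (T.resPow β 1) ⊆ range (T.resPow β ε) := by
  have h : ∀ n : ℕ, range (T.resPow β 1) ⊆ range (T.resPow β ((3 / 2) ^ n)) := by
    intro n
    induction n with
    | zero => simp
    | succ n ih =>
      refine ih.trans (T.range_resPow_le_of_lt hβ (by positivity) ?_)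
      rw [pow_succ']
      have : (0 : ℝ) < (3 / 2) ^ n := by positivity
      linarith
  obtain ⟨n, hn⟩ := pow_unbounded_of_one_lt ε (by norm_num : (1 : ℝ) < 3 / 2)
  exact (h n).trans (T.range_resPow_le_of_lt hβ hε (by linarith))

/-- `δ ^ β (δ - A)^{-β}` converges strongly to the identity as `δ → ∞`. -/
theorem tendsto_rpow_smul_resPow {β : ℝ} (hβ : 0 < β) (x : X) :
    Tendsto (fun δ : ℝ => δ ^ β • T.resPow β δ x) atTop (𝓝 x) := by
  have hint : ∀ δ : ℝ, 0 < δ → δ ^ β • T.resPow β δ x =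
      ∫ s, fracKernel β 1 s • T.orbitExt x (δ⁻¹ * s) := by
    intro δ hδ
    have h := Measure.integral_comp_mul_left (fun t => fracKernel β δ t • T.orbitExt x t) δ⁻¹
    rw [inv_inv, abs_of_pos hδ, ← negFracPow_eq, ← T.resPow_apply hβ hδ] at h
    have h2 : δ ^ β • T.resPow β δ x = δ ^ (β - 1) • δ • T.resPow β δ x := by
      rw [smul_smul, Real.rpow_sub_one hδ.ne', div_mul_cancel₀ _ hδ.ne']
    rw [h2, ← h, ← integral_smul]
    congr 1
    funext s
    rw [smul_smul]
    congr 1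
    by_cases hs : s ∈ Ioi (0 : ℝ)
    · have hs' : 0 < s := hs
      have hs2 : δ⁻¹ * s ∈ Ioi (0 : ℝ) := by
        rw [mem_Ioi]
        positivity
      simp only [fracKernel, indicator_of_mem hs, indicator_of_mem hs2]
      rw [Real.mul_rpow (by positivity) hs'.le, Real.inv_rpow hδ.le, one_mul,
        mul_inv_cancel_left₀ hδ.ne']
      have := (Real.rpow_pos_of_pos hδ (β - 1)).ne'
      field_simp
    · have hs2 : δ⁻¹ * s ∉ Ioi (0 : ℝ) := by
        rw [mem_Ioi, not_lt] at hs ⊢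
        exact mul_nonpos_of_nonneg_of_nonpos (by positivity) hs
      simp only [fracKernel, indicator_of_notMem hs, indicator_of_notMem hs2, mul_zero]
  have hlim : Tendsto (fun δ : ℝ => ∫ s, fracKernel β 1 s • T.orbitExt x (δ⁻¹ * s)) atTop
      (𝓝 (∫ s, fracKernel β 1 s • x)) := by
    refine tendsto_integral_filter_of_dominated_convergence
      (fun s => fracKernel β 1 s * (T.bd * ‖x‖)) ?_ ?_
      ((integrable_fracKernel hβ one_pos).mul_const _) ?_
    · filter_upwards [eventually_gt_atTop 0] with δ hδ
      have hq : Measure.QuasiMeasurePreserving (fun s : ℝ => δ⁻¹ * s) volume volume :=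
        Measure.quasiMeasurePreserving_smul (volume : Measure ℝ) (inv_ne_zero hδ.ne')
      exact (integrable_fracKernel hβ one_pos).aestronglyMeasurable.smul
        ((T.aestronglyMeasurable_orbitExt x).comp_quasiMeasurePreserving hq)
    · refine Eventually.of_forall fun δ => Eventually.of_forall fun s => ?_
      rw [norm_smul, Real.norm_of_nonneg (fracKernel_nonneg hβ 1 s)]
      exact mul_le_mul_of_nonneg_left (T.norm_orbitExt_le x _) (fracKernel_nonneg hβ 1 s)
    · refine Eventually.of_forall fun s => ?_
      by_cases hs : s ∈ Ioi (0 : ℝ)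
      · refine Tendsto.const_smul ?_ _
        have h0 : Tendsto (fun δ : ℝ => δ⁻¹ * s) atTop (𝓝[≥] 0) := by
          refine tendsto_nhdsWithin_iff.2 ⟨?_, ?_⟩
          · simpa using tendsto_inv_atTop_zero.mul_const s
          · filter_upwards [eventually_gt_atTop 0] with δ hδ
            exact mul_nonneg (inv_nonneg.2 (le_of_lt hδ)) (le_of_lt hs)
        have h1 := (T.continuousOn_orbit x 0 self_mem_Ici).tendsto.comp h0
        rw [T.op_zero, one_apply_eq_self] at h1
        refine h1.congr' ?_
        filter_upwards [eventually_gt_atTop 0] with δ hδ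
        have : δ⁻¹ * s ∈ Ioi (0 : ℝ) := mul_pos (inv_pos.2 hδ) hs
        rw [orbitExt, indicator_of_mem this]
        rfl
      · simp only [fracKernel, indicator_of_notMem hs, zero_smul]
        exact tendsto_const_nhds
  rw [integral_smul_const, integral_fracKernel hβ one_pos, Real.one_rpow, one_smul] at hlim
  refine hlim.congr' ?_
  filter_upwards [eventually_gt_atTop 0] with δ hδ
  exact (hint δ hδ).symm

theorem denseRange_resPow {β : ℝ} (hβ : 0 < β) : DenseRange (T.resPow β 1) := by
  intro x
  refine mem_closure_of_tendsto (T.tendsto_rpow_smul_resPow hβ x) ?_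
  filter_upwards [eventually_ge_atTop 1] with δ hδ
  obtain ⟨y, hy⟩ := T.range_resPow_le_of_lt hβ one_pos (by linarith : 1 < 2 * δ) ⟨x, rfl⟩
  exact ⟨((δ ^ β : ℝ) : ℂ) • y, by rw [map_smul, hy, Complex.coe_smul]⟩

/-- The range of the resolvent `R = (1 - A)⁻¹` lies in `D(A)`, and `A R x = R x - x`. -/
theorem resPow_one_mem_generator_graph (x : X) :
    (T.resPow 1 1 x, T.resPow 1 1 x - x) ∈ T.generator.graph := by
  rw [T.mem_generator_graph]
  set f : ℝ → X := fun t => Real.exp (-t) • T.op t x with hf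
  have hec : ContinuousOn (fun t : ℝ => Real.exp (-t)) (Ici 0) := by fun_prop
  have hfc : ContinuousOn f (Ici 0) := hec.smul (T.continuousOn_orbit x)
  have hfi : IntegrableOn f (Ioi 0) := by
    have h := (T.integrable_fracKernel_smul one_pos one_pos x).integrableOn (s := Ioi 0)
    refine IntegrableOn.congr_fun h (fun t ht => ?_) measurableSet_Ioi
    simp [fracKernel, orbitExt, indicator_of_mem ht, hf]
  have hR : T.resPow 1 1 x = ∫ t in Ioi (0 : ℝ), f t := by
    rw [T.resPow_apply one_pos one_pos, negFracPow]
    simp [hf]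
  have horbit : ∀ h : ℝ, 0 ≤ h →
      T.op h (T.resPow 1 1 x) = Real.exp h • (T.resPow 1 1 x - ∫ t in (0 : ℝ)..h, f t) := by
    intro h hh
    rw [hR, ← ContinuousLinearMap.integral_comp_comm _ hfi]
    have e1 : ∫ t in Ioi (0 : ℝ), f (t + h) = ∫ t in Ioi h, f t := by
      rw [← integral_indicator measurableSet_Ioi, ← integral_indicator measurableSet_Ioi,
        ← integral_add_right_eq_self ((Ioi h).indicator f) h]
      congr 1
      funext t
      simp [indicator]
    have e2 : ∀ t ∈ Ioi (0 : ℝ), T.op h (f t) = Real.exp h • f (t + h) := by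
      intro t ht
      simp only [hf]
      rw [add_comm t h, T.op_add h t hh (le_of_lt ht), ContinuousLinearMap.map_smul_of_tower,
        smul_smul, ← Real.exp_add, show h + -(h + t) = -t by ring]
      rfl
    rw [setIntegral_congr_fun measurableSet_Ioi e2, integral_smul, e1,
      ← intervalIntegral.integral_Ioi_sub_Ioi hfi hh, sub_sub_cancel]
  have hd : HasDerivWithinAt (fun u => ∫ t in (0 : ℝ)..u, f t) (f 0) (Ici 0) 0 := by
    have hmeas : StronglyMeasurableAtFilter f (𝓝[>] 0) :=
      ⟨Ioi 0, self_mem_nhdsWithin, hfi.aestronglyMeasurable⟩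
    exact intervalIntegral.integral_hasDerivWithinAt_right
      (IntervalIntegrable.refl : IntervalIntegrable f volume 0 0) hmeas
      ((hfc 0 self_mem_Ici).mono Ioi_subset_Ici_self)
  have hG := ((Real.hasDerivAt_exp 0).hasDerivWithinAt (s := Ici 0)).smul
    (hd.const_sub (T.resPow 1 1 x))
  rw [hasDerivWithinAt_iff_tendsto_slope, Ici_sdiff_left] at hG
  simp only [hf, Real.exp_zero, neg_zero, one_smul, T.op_zero, one_apply_eq_self,
    intervalIntegral.integral_same, sub_zero] at hG
  rw [neg_add_eq_sub] at hG
  refine hG.congr' ?_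
  filter_upwards [self_mem_nhdsWithin] with h hh
  rw [slope_def_module, horbit h (le_of_lt hh)]
  simp [hf]

end BoundedC0Semigroup

/-! ### The domain of the fractional power -/

namespace BoundedC0Semigroup

variable {X : Type*} [NormedAddCommGroup X] [NormedSpace ℂ X] [CompleteSpace X]
  (T : BoundedC0Semigroup X)

/-- The bounded operator `(-A)^β (1 - A)^{-β} = (1 - Q)^β` with `Q = (1 - A)⁻¹`. -/
noncomputable def fracRatio (β : ℝ) : X →L[ℂ] X := binPow (T.scaledRes 1) β 1

/-- `(-A)^β` is the operator with domain the range of `(1 - A)^{-β}` that maps `(1 - A)^{-β} z` to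
`(1 - Q)^β z`. -/
theorem mem_fracPow_graph_iff {β : ℝ} (hβ : 0 < β) (x y : X) :
    (x, y) ∈ (T.fracPow β hβ).graph ↔ ∃ z, T.resPow β 1 z = x ∧ T.fracRatio β z = y := by
  have key : ∀ z, (T.resPow β 1 z, T.fracRatio β z) ∈ (T.fracPow β hβ).graph := by
    intro z
    rw [T.mem_fracPow_graph β hβ]
    have hex : ∀ ε : ℝ, 0 < ε → ∃ w, T.resPow β ε w = T.resPow β 1 z := fun ε hε =>
      T.range_resPow_one_le hβ hε ⟨z, rfl⟩
    choose! w hw using hex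
    refine ⟨w, fun ε hε => by rw [← T.resPow_apply hβ hε, hw ε hε], ?_⟩
    have h := (ContinuousLinearMap.apply ℂ X z).continuous.tendsto (T.fracRatio β)
    refine (h.comp (tendsto_binPow_one (T.norm_scaledRes_pow_le one_pos) hβ)).congr' ?_
    filter_upwards [Ioo_mem_nhdsGT (zero_lt_two' ℝ)] with ε hε
    refine T.resPow_injective hβ hε.1 ?_
    have h2 := T.resPow_mul_binPow (δ := 1) hβ hε.1 (by linarith [hε.2])
    rw [div_one] at h2
    rw [hw ε hε.1, ← h2]
    rfl
  constructor
  · intro h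
    obtain ⟨w, hw, -⟩ := (T.mem_fracPow_graph β hβ x y).1 h
    refine ⟨w 1, by rw [T.resPow_apply hβ one_pos, hw 1 one_pos], ?_⟩
    have h1 := key (w 1)
    rw [T.resPow_apply hβ one_pos, hw 1 one_pos] at h1
    exact LinearPMap.mem_graph_snd_inj _ h1 h rfl
  · rintro ⟨z, rfl, rfl⟩
    exact key z

theorem mem_fracPow_domain_iff {β : ℝ} (hβ : 0 < β) (x : X) :
    x ∈ (T.fracPow β hβ).domain ↔ ∃ z, T.resPow β 1 z = x := by
  rw [LinearPMap.mem_domain_iff]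
  simp only [T.mem_fracPow_graph_iff hβ]
  exact ⟨fun ⟨_, z, hz, _⟩ => ⟨z, hz⟩, fun ⟨z, hz⟩ => ⟨_, z, hz, rfl⟩⟩

/-- A Bézout identity for `(1 - A)^{-β}` and `(-A)^β (1 - A)^{-β}`. It follows from the one for the
coprime polynomials `q ^ n` and `(1 - q) ^ n` with `n > β`. -/
theorem exists_bezout {β : ℝ} (hβ : 0 < β) :
    ∃ a b : X →L[ℂ] X, a * T.resPow β 1 + b * T.fracRatio β = 1 := by
  obtain ⟨m, hm⟩ := exists_nat_gt β
  set Q := T.scaledRes 1 with hQ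
  have hm' : 0 < (m : ℝ) + 1 - β := by linarith
  have h1 : T.resPow (m + 1 - β) 1 * T.resPow β 1 = Q ^ (m + 1) := by
    have h := T.resPow_mul_scaledRes_pow one_pos one_pos m
    have h2 : T.resPow 1 1 = Q := by simp [hQ, scaledRes]
    rw [one_pow, Complex.ofReal_one, one_smul, h2, ← pow_succ'] at h
    rw [T.resPow_mul_resPow hm' hβ one_pos, h]
    congr 1
    ring
  have h2 : binPow Q (m + 1 - β) 1 * T.fracRatio β = (1 - Q) ^ (m + 1) := by
    rw [fracRatio, binPow_mul_binPow (T.norm_scaledRes_pow_le one_pos) (binSummable_one hm')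
      (binSummable_one hβ), sub_add_cancel, binPow_natCast (T.norm_scaledRes_pow_le one_pos)]
  have hcop : IsCoprime ((Polynomial.X : Polynomial ℂ) ^ (m + 1)) ((1 - Polynomial.X) ^ (m + 1)) :=
    IsCoprime.pow ⟨1, 1, by ring⟩
  obtain ⟨u, v, huv⟩ := hcop
  have h3 := congrArg (Polynomial.aeval Q) huv
  simp only [map_add, map_mul, map_pow, map_sub, map_one, Polynomial.aeval_X] at h3
  rw [← h1, ← h2, ← mul_assoc, ← mul_assoc] at h3
  exact ⟨_, _, h3⟩

/-- The operator `(1 - A)^{-β}` is an isomorphism of `X` onto `D((-A)^β)` with the graph norm. -/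
theorem exists_equiv_graphDomain {β : ℝ} (hβ : 0 < β) :
    ∃ E : X ≃L[ℂ] GraphDomain (T.fracPow β hβ),
      ∀ z, GraphDomain.incl (T.fracPow β hβ) (E z) = T.resPow β 1 z := by
  set B := T.fracPow β hβ with hB
  obtain ⟨a, b, hab⟩ := T.exists_bezout hβ
  have hgraph : ∀ z, ∃ x : GraphDomain B, GraphDomain.incl B x = T.resPow β 1 z ∧
      GraphDomain.apply B x = T.fracRatio β z := by
    intro z
    exact (LinearPMap.mem_graph_iff B).1 ((T.mem_fracPow_graph_iff hβ _ _).2 ⟨z, rfl, rfl⟩)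
  have hinj : Function.Injective (GraphDomain.incl B) := Subtype.val_injective
  choose e he1 he2 using hgraph
  let E : X →L[ℂ] GraphDomain B := LinearMap.mkContinuous
    { toFun := e
      map_add' := fun z w => hinj (by simp only [map_add, he1])
      map_smul' := fun c z => hinj (by simp only [map_smul, he1, RingHom.id_apply]) }
    (‖T.resPow β 1‖ + ‖T.fracRatio β‖) fun z => by
      change ‖e z‖ ≤ _
      rw [GraphDomain.norm_def, he1, he2, add_mul]
      exact add_le_add (ContinuousLinearMap.le_opNorm _ z) (ContinuousLinearMap.le_opNorm _ z)
  let K : GraphDomain B →L[ℂ] X := LinearMap.mkContinuous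
    (a.toLinearMap ∘ₗ GraphDomain.incl B + b.toLinearMap ∘ₗ GraphDomain.apply B)
    (‖a‖ + ‖b‖) fun x => by
      rw [GraphDomain.norm_def]
      refine (norm_add_le _ _).trans ?_
      have h1 : ‖a (GraphDomain.incl B x)‖ ≤ _ := a.le_opNorm _
      have h2 : ‖b (GraphDomain.apply B x)‖ ≤ _ := b.le_opNorm _
      refine (add_le_add h1 h2).trans ?_
      rw [add_mul]
      gcongr <;> linarith [norm_nonneg (GraphDomain.incl B x), norm_nonneg (GraphDomain.apply B x)]
  have hKE : ∀ z, K (E z) = z := by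
    intro z
    change a (GraphDomain.incl B (e z)) + b (GraphDomain.apply B (e z)) = z
    rw [he1, he2]
    exact congrArg (fun S : X →L[ℂ] X => S z) hab
  have hEK : ∀ x, E (K x) = x := by
    intro x
    obtain ⟨z, hz⟩ := (T.mem_fracPow_domain_iff hβ _).1 x.2
    have hx : E z = x := hinj ((he1 z).trans hz)
    rw [← hx, hKE]
  exact ⟨ContinuousLinearEquiv.equivOfInverse E K hKE hEK, he1⟩

/-- `D((-A)^{β+1})` is the image of `D(A)` under `(1 - A)^{-β}`. -/
theorem mem_fracPow_add_one_domain_iff {β : ℝ} (hβ : 0 < β) (h : 0 < β + 1) (x : X) :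
    x ∈ (T.fracPow (β + 1) h).domain ↔ ∃ w, T.resPow β 1 (T.resPow 1 1 w) = x := by
  rw [T.mem_fracPow_domain_iff, ← T.resPow_mul_resPow hβ one_pos one_pos]
  rfl

end BoundedC0Semigroup

/-! ### Sesquilinear forms along orbits -/

section Sesquilinear

variable {X : Type*} [NormedAddCommGroup X] [NormedSpace ℂ X]

theorem continuous_sesquilinear (S : X →L[ℂ] X →L⋆[ℂ] ℂ) :
    Continuous fun p : X × X => S p.1 p.2 := by
  have h : IsBoundedBilinearMap ℝ fun p : X × X => S p.1 p.2 :=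
    { add_left := fun x y z => by simp
      smul_left := fun c x y => by
        rw [← Complex.coe_smul c x, map_smul]
        simp
      add_right := fun x y z => by simp
      smul_right := fun c x y => by
        rw [← Complex.coe_smul c y, ContinuousLinearMap.map_smulₛₗ, Complex.conj_ofReal,
          Complex.coe_smul]
      bound := ⟨‖S‖ + 1, by positivity, fun x y => (S.le_opNorm₂ x y).trans (by gcongr; linarith)⟩ }
  exact h.continuous

theorem tendsto_sesquilinear (S : X →L[ℂ] X →L⋆[ℂ] ℂ) {ι : Type*} {l : Filter ι} {u v : ι → X}
    {a b : X} (hu : Tendsto u l (𝓝 a)) (hv : Tendsto v l (𝓝 b)) :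
    Tendsto (fun i => S (u i) (v i)) l (𝓝 (S a b)) :=
  ((continuous_sesquilinear S).tendsto (a, b)).comp (hu.prodMk_nhds hv)

theorem hasDerivWithinAt_sesquilinear (S : X →L[ℂ] X →L⋆[ℂ] ℂ) {f g : ℝ → X} {f' g' : X}
    {s : Set ℝ} {t : ℝ} (hf : HasDerivWithinAt f f' s t) (hg : HasDerivWithinAt g g' s t) :
    HasDerivWithinAt (fun τ => S (f τ) (g τ)) (S f' (g t) + S (f t) g') s t := by
  have hgc : Tendsto g (𝓝[s \ {t}] t) (𝓝 (g t)) :=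
    hg.continuousWithinAt.tendsto.mono_left (nhdsWithin_mono _ sdiff_subset)
  rw [hasDerivWithinAt_iff_tendsto_slope] at hf hg ⊢
  refine ((tendsto_sesquilinear S hf hgc).add
    (tendsto_sesquilinear S (tendsto_const_nhds (x := f t)) hg)).congr fun τ => ?_
  simp only [slope_def_module, ← Complex.coe_smul, map_smul, map_sub,
    ContinuousLinearMap.map_smulₛₗ, smul_apply, sub_apply, Complex.conj_ofReal, smul_eq_mul]
  ring

/-- The sesquilinear form `(z, w) ↦ ⟨C z, C w⟩`, linear in `z`. -/
noncomputable def innerForm {Y : Type*} [NormedAddCommGroup Y] [InnerProductSpace ℂ Y]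
    (C : X →L[ℂ] Y) : X →L[ℂ] X →L⋆[ℂ] ℂ :=
  (innerSLFlip ℂ).bilinearComp C C

theorem innerForm_apply {Y : Type*} [NormedAddCommGroup Y] [InnerProductSpace ℂ Y]
    (C : X →L[ℂ] Y) (z w : X) : innerForm C z w = inner ℂ (C w) (C z) := rfl

end Sesquilinear

namespace BoundedC0Semigroup

variable {X : Type*} [NormedAddCommGroup X] [InnerProductSpace ℂ X] (T : BoundedC0Semigroup X)

theorem op_generator_graph {t : ℝ} (ht : 0 ≤ t) {z z' : X} (hz : (z, z') ∈ T.generator.graph) :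
    (T.op t z, T.op t z') ∈ T.generator.graph :=
  T.map_mem_generator_graph (fun _ hs x => T.op_comm hs ht x) hz

/-- Orbits of `z ∈ D(A)` have the right derivative `T(t) A z` at `t`. -/
theorem hasDerivWithinAt_op {z z' : X} (hz : (z, z') ∈ T.generator.graph) {t : ℝ} (ht : 0 ≤ t) :
    HasDerivWithinAt (fun s => T.op s z) (T.op t z') (Ioi t) t := by
  have h := (T.mem_generator_graph _ _).1 (T.op_generator_graph ht hz)
  rw [hasDerivWithinAt_iff_tendsto_slope' (by simp)]
  have hsub : Tendsto (fun s => s - t) (𝓝[>] t) (𝓝[>] 0) := by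
    refine tendsto_nhdsWithin_iff.2 ⟨?_, ?_⟩
    · have : Tendsto (fun s => s - t) (𝓝 t) (𝓝 (t - t)) := tendsto_id.sub_const t
      rw [sub_self] at this
      exact this.mono_left nhdsWithin_le_nhds
    · filter_upwards [self_mem_nhdsWithin] with s hs
      exact sub_pos.2 (mem_Ioi.1 hs)
  refine (h.comp hsub).congr' ?_
  filter_upwards [self_mem_nhdsWithin] with s hs
  have h1 : T.op s z = T.op (s - t) (T.op t z) := by
    have := T.op_add (s - t) t (sub_nonneg.2 (le_of_lt (mem_Ioi.1 hs))) ht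
    rw [sub_add_cancel] at this
    rw [this]
    rfl
  rw [slope_def_module, h1]
  rfl

theorem continuousOn_sesquilinear_orbit (S : X →L[ℂ] X →L⋆[ℂ] ℂ) (z w : X) :
    ContinuousOn (fun t => S (T.op t z) (T.op t w)) (Ici 0) :=
  (continuous_sesquilinear S).comp_continuousOn
    ((T.continuousOn_orbit z).prodMk (T.continuousOn_orbit w))

theorem intervalIntegrable_sesquilinear_orbit (S : X →L[ℂ] X →L⋆[ℂ] ℂ) (z w : X) {t : ℝ}
    (ht : 0 ≤ t) : IntervalIntegrable (fun s => S (T.op s z) (T.op s w)) volume 0 t := by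
  refine ContinuousOn.intervalIntegrable ((T.continuousOn_sesquilinear_orbit S z w).mono ?_)
  rw [uIcc_of_le ht]
  exact Icc_subset_Ici_self

/-- The fundamental theorem of calculus for `t ↦ S (T(t) z) (T(t) w)` with `z, w ∈ D(A)`. -/
theorem integral_sesquilinear_orbit (S : X →L[ℂ] X →L⋆[ℂ] ℂ) {z z' w w' : X}
    (hz : (z, z') ∈ T.generator.graph) (hw : (w, w') ∈ T.generator.graph) {t : ℝ} (ht : 0 ≤ t) :
    ∫ s in (0 : ℝ)..t, (S (T.op s z') (T.op s w) + S (T.op s z) (T.op s w')) =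
      S (T.op t z) (T.op t w) - S z w := by
  have h := intervalIntegral.integral_eq_sub_of_hasDeriv_right_of_le ht
    ((T.continuousOn_sesquilinear_orbit S z w).mono Icc_subset_Ici_self)
    (fun s hs => hasDerivWithinAt_sesquilinear S (T.hasDerivWithinAt_op hz hs.1.le)
      (T.hasDerivWithinAt_op hw hs.1.le))
    ((T.intervalIntegrable_sesquilinear_orbit S z' w ht).add
      (T.intervalIntegrable_sesquilinear_orbit S z w' ht))
  rw [h, T.op_zero]
  rfl

/-- By dominated convergence: orbits with nearby initial values have a common bound. -/
theorem continuous_integral_sesquilinear_orbit (S : X →L[ℂ] X →L⋆[ℂ] ℂ) {t : ℝ} (ht : 0 ≤ t) :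
    Continuous fun p : X × X => ∫ s in (0 : ℝ)..t, S (T.op s p.1) (T.op s p.2) := by
  have hM := T.bd_pos
  refine continuous_iff_continuousAt.2 fun p₀ => ?_
  refine intervalIntegral.continuousAt_of_dominated_interval
    (bound := fun _ => ‖S‖ * (T.bd * (‖p₀.1‖ + 1)) * (T.bd * (‖p₀.2‖ + 1))) ?_ ?_
    intervalIntegrable_const ?_
  · refine Eventually.of_forall fun p => ?_
    exact (intervalIntegrable_iff.1
      (T.intervalIntegrable_sesquilinear_orbit S p.1 p.2 ht)).aestronglyMeasurable
  · have h1 : ∀ᶠ p : X × X in 𝓝 p₀, ‖p.1‖ < ‖p₀.1‖ + 1 :=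
      continuous_fst.norm.continuousAt.eventually_lt_const (lt_add_one _)
    have h2 : ∀ᶠ p : X × X in 𝓝 p₀, ‖p.2‖ < ‖p₀.2‖ + 1 :=
      continuous_snd.norm.continuousAt.eventually_lt_const (lt_add_one _)
    filter_upwards [h1, h2] with p hp1 hp2
    refine Eventually.of_forall fun s hs => ?_
    rw [uIoc_of_le ht] at hs
    refine (S.le_opNorm₂ _ _).trans ?_
    gcongr
    · exact (T.norm_op_apply_le hs.1.le _).trans (by gcongr)
    · exact (T.norm_op_apply_le hs.1.le _).trans (by gcongr)
  · refine Eventually.of_forall fun s _ => Continuous.continuousAt ?_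
    exact (continuous_sesquilinear S).comp
      (by fun_prop : Continuous fun p : X × X => (T.op s p.1, T.op s p.2))

/-! ### The Lyapunov equation for a bounded observation operator -/

theorem aestronglyMeasurable_orbit (y : X) :
    AEStronglyMeasurable (fun t => T.op t y) (volume.restrict (Ioi 0)) :=
  ((T.continuousOn_orbit y).mono Ioi_subset_Ici_self).aestronglyMeasurable measurableSet_Ioi

/-- A square integrable orbit of a bounded semigroup tends to zero, because
`t ‖T(t) y‖² ≤ M² ∫ ‖T(s) y‖² ds`. -/
theorem tendsto_zero_of_memLp {y : X}
    (hy : MemLp (fun t : ℝ => T.op t y) 2 (volume.restrict (Ioi 0))) :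
    Tendsto (fun t => T.op t y) atTop (𝓝 0) := by
  have hint : IntegrableOn (fun t => ‖T.op t y‖ ^ 2) (Ioi 0) :=
    (memLp_two_iff_integrable_sq_norm (T.aestronglyMeasurable_orbit y)).1 hy
  set I := ∫ t in Ioi (0 : ℝ), ‖T.op t y‖ ^ 2 with hI
  have hbound : ∀ t : ℝ, 0 < t → ‖T.op t y‖ ^ 2 ≤ T.bd ^ 2 * I * t⁻¹ := by
    intro t ht
    have h1 : ∫ _ in Ioc 0 t, ‖T.op t y‖ ^ 2 ≤ ∫ s in Ioc 0 t, T.bd ^ 2 * ‖T.op s y‖ ^ 2 := by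
      refine setIntegral_mono_on (integrableOn_const (by simp))
        ((hint.mono_set Ioc_subset_Ioi_self).const_mul _) measurableSet_Ioc fun s hs => ?_
      have h2 : T.op t y = T.op (t - s) (T.op s y) := by
        have := T.op_add (t - s) s (sub_nonneg.2 hs.2) hs.1.le
        rw [sub_add_cancel] at this
        rw [this]
        rfl
      rw [h2, ← mul_pow]
      gcongr
      exact T.norm_op_apply_le (sub_nonneg.2 hs.2) _
    have h3 : ∫ s in Ioc 0 t, ‖T.op s y‖ ^ 2 ≤ I :=
      setIntegral_mono_set hint (Eventually.of_forall fun s => by positivity)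
        (Eventually.of_forall Ioc_subset_Ioi_self)
    rw [setIntegral_const, integral_const_mul] at h1
    simp only [Real.volume_real_Ioc, sub_zero, max_eq_left ht.le, smul_eq_mul] at h1
    rw [le_mul_inv_iff₀ ht, mul_comm]
    exact h1.trans (by gcongr)
  have h0 : Tendsto (fun t => ‖T.op t y‖ ^ 2) atTop (𝓝 0) := by
    refine squeeze_zero' (Eventually.of_forall fun t => by positivity)
      ((eventually_gt_atTop 0).mono hbound) ?_
    simpa using tendsto_inv_atTop_zero.const_mul (T.bd ^ 2 * I)
  have h1 := h0.sqrt
  simp only [Real.sqrt_sq (norm_nonneg _), Real.sqrt_zero] at h1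
  exact tendsto_zero_iff_norm_tendsto_zero.2 h1

/-- A bounded semigroup is strongly stable if its orbits tend to zero on a dense set. -/
theorem tendsto_zero_of_denseRange {ι : Type*} {f : ι → X} (hf : DenseRange f)
    (h : ∀ i, Tendsto (fun t => T.op t (f i)) atTop (𝓝 0)) (x : X) :
    Tendsto (fun t => T.op t x) atTop (𝓝 0) := by
  have hM := T.bd_pos
  refine Metric.tendsto_nhds.2 fun ε hε => ?_
  obtain ⟨i, hi⟩ := hf.exists_dist_lt x (show 0 < ε / (2 * T.bd) by positivity)
  filter_upwards [Metric.tendsto_nhds.1 (h i) (ε / 2) (half_pos hε), eventually_ge_atTop 0]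
    with t ht ht0
  rw [dist_zero_right] at ht ⊢
  rw [dist_eq_norm] at hi
  calc ‖T.op t x‖ = ‖T.op t (x - f i) + T.op t (f i)‖ := by rw [map_sub, sub_add_cancel]
    _ ≤ T.bd * ‖x - f i‖ + ‖T.op t (f i)‖ :=
        (norm_add_le _ _).trans (by gcongr; exact T.norm_op_apply_le ht0 _)
    _ < T.bd * (ε / (2 * T.bd)) + ε / 2 := by gcongr
    _ = ε := by field_simp; ring

variable [CompleteSpace X]

/-- The Lyapunov equation for a sesquilinear form `G` with right-hand side `-S`, on the domain
`{R a}` of the generator, where `R = (1 - A)⁻¹` and `A R a = R a - a`. -/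
def IsLyapunovForm (S G : X →L[ℂ] X →L⋆[ℂ] ℂ) : Prop :=
  ∀ a b, G (T.resPow 1 1 a - a) (T.resPow 1 1 b) + G (T.resPow 1 1 a) (T.resPow 1 1 b - b) =
    -S (T.resPow 1 1 a) (T.resPow 1 1 b)

variable {T} in
/-- The integrated Lyapunov equation. It extends from `D(A)` to `X` by continuity. -/
theorem IsLyapunovForm.integral_eq {S G : X →L[ℂ] X →L⋆[ℂ] ℂ} (h : T.IsLyapunovForm S G) {t : ℝ}
    (ht : 0 ≤ t) (z w : X) :
    ∫ s in (0 : ℝ)..t, S (T.op s z) (T.op s w) = G z w - G (T.op t z) (T.op t w) := by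
  have hdense := T.denseRange_resPow one_pos
  have hc1 := T.continuous_integral_sesquilinear_orbit S ht
  have hc2 : Continuous fun p : X × X => G p.1 p.2 - G (T.op t p.1) (T.op t p.2) :=
    (continuous_sesquilinear G).sub ((continuous_sesquilinear G).comp
      (by fun_prop : Continuous fun p : X × X => (T.op t p.1, T.op t p.2)))
  refine isClosed_property2 (p := fun z w => ∫ s in (0 : ℝ)..t, S (T.op s z) (T.op s w) =
    G z w - G (T.op t z) (T.op t w)) hdense (isClosed_eq hc1 hc2) (fun a b => ?_) z w
  have h1 := T.integral_sesquilinear_orbit G (T.resPow_one_mem_generator_graph a)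
    (T.resPow_one_mem_generator_graph b) ht
  rw [← neg_inj, neg_sub, ← h1, ← intervalIntegral.integral_neg]
  refine intervalIntegral.integral_congr fun s hs => ?_
  rw [uIcc_of_le ht] at hs
  have h2 := h (T.op s a) (T.op s b)
  simp only [← T.op_resPow hs.1, ← map_sub (T.op s)] at h2
  exact h2.symm

variable {T} in
/-- The orbits `C T(·) z` are square integrable if the Lyapunov equation has a nonnegative
solution. -/
theorem IsLyapunovForm.memLp {C : X →L[ℂ] X}
    (hC : ∀ t : ℝ, 0 ≤ t → ∀ x, T.op t (C x) = C (T.op t x))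
    {G : X →L[ℂ] X →L⋆[ℂ] ℂ} (h : T.IsLyapunovForm (innerForm C) G)
    (hG : ∀ z, 0 ≤ (G z z).re) (z : X) :
    MemLp (fun t : ℝ => T.op t (C z)) 2 (volume.restrict (Ioi 0)) := by
  rw [memLp_two_iff_integrable_sq_norm (T.aestronglyMeasurable_orbit _)]
  have hcont : ContinuousOn (fun t => ‖T.op t (C z)‖ ^ 2) (Ici 0) :=
    (T.continuousOn_orbit (C z)).norm.pow 2
  refine integrableOn_Ioi_of_intervalIntegral_norm_bounded (l := atTop) (b := id) (G z z).re 0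
    (fun t => ?_) tendsto_id ?_
  · exact ((hcont.mono Icc_subset_Ici_self).integrableOn_Icc).mono_set Ioc_subset_Icc_self
  · filter_upwards [eventually_ge_atTop 0] with t ht
    have h1 := h.integral_eq ht z z
    have h2 : ∫ s in (0 : ℝ)..t, innerForm C (T.op s z) (T.op s z) =
        ((∫ s in (0 : ℝ)..t, ‖‖T.op s (C z)‖ ^ 2‖ : ℝ) : ℂ) := by
      rw [← intervalIntegral.integral_ofReal]
      refine intervalIntegral.integral_congr fun s hs => ?_
      rw [uIcc_of_le ht] at hs
      simp only [innerForm_apply]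
      rw [← hC s hs.1, inner_self_eq_norm_sq_to_K, Real.norm_of_nonneg (by positivity)]
      push_cast
      rfl
    rw [h2] at h1
    have h3 := congrArg Complex.re h1
    rw [Complex.ofReal_re, Complex.sub_re] at h3
    have := hG (T.op t z)
    simp only [id]
    linarith

/-- The inner product of two square integrable functions is integrable. -/
theorem _root_.MeasureTheory.MemLp.integrable_inner_complex {α E : Type*} [MeasurableSpace α]
    {μ : Measure α} [NormedAddCommGroup E] [InnerProductSpace ℂ E] {f g : α → E} (hf : MemLp f 2 μ)
    (hg : MemLp g 2 μ) : Integrable (fun t => (inner ℂ (f t) (g t) : ℂ)) μ := by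
  refine (L2.integrable_inner (𝕜 := ℂ) (hf.toLp f) (hg.toLp g)).congr ?_
  filter_upwards [hf.coeFn_toLp, hg.coeFn_toLp] with t h1 h2
  rw [h1, h2]

variable {T} in
/-- A nonnegative solution of the Lyapunov equation is the Gramian `∫ ⟨T(t) C z, T(t) C w⟩ dt`,
because the semigroup is strongly stable. -/
theorem IsLyapunovForm.eq_integral {C : X →L[ℂ] X}
    (hC : ∀ t : ℝ, 0 ≤ t → ∀ x, T.op t (C x) = C (T.op t x)) (hd : DenseRange C)
    {G : X →L[ℂ] X →L⋆[ℂ] ℂ} (h : T.IsLyapunovForm (innerForm C) G)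
    (hG : ∀ z, 0 ≤ (G z z).re) (z w : X) :
    IntegrableOn (fun t => (inner ℂ (T.op t (C w)) (T.op t (C z)) : ℂ)) (Ioi 0) ∧
      G z w = ∫ t in Ioi (0 : ℝ), (inner ℂ (T.op t (C w)) (T.op t (C z)) : ℂ) := by
  have hL := h.memLp hC hG
  have hint : IntegrableOn (fun t => (inner ℂ (T.op t (C w)) (T.op t (C z)) : ℂ)) (Ioi 0) :=
    (hL w).integrable_inner_complex (hL z)
  refine ⟨hint, ?_⟩
  have hstab := T.tendsto_zero_of_denseRange hd fun z => T.tendsto_zero_of_memLp (hL z)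
  have h1 := intervalIntegral_tendsto_integral_Ioi 0 hint tendsto_id
  have h2 : Tendsto (fun t => G z w - G (T.op t z) (T.op t w)) atTop (𝓝 (G z w - G 0 0)) :=
    tendsto_const_nhds.sub (tendsto_sesquilinear G (hstab z) (hstab w))
  rw [map_zero, sub_zero] at h2
  refine tendsto_nhds_unique (h2.congr' ?_) h1
  filter_upwards [eventually_ge_atTop 0] with t ht
  rw [← h.integral_eq ht z w]
  refine intervalIntegral.integral_congr fun s hs => ?_
  rw [uIcc_of_le ht] at hs
  simp only [innerForm_apply, hC s hs.1]

/-- If all orbits `T(·) C z` are square integrable, then by the closed graph theorem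
`z ↦ T(·) C z` is bounded from `X` to `L²(0, ∞; X)`. -/
theorem exists_orbit_Lp {C : X →L[ℂ] X}
    (hL : ∀ z, MemLp (fun t : ℝ => T.op t (C z)) 2 (volume.restrict (Ioi 0))) :
    ∃ L : X →L[ℂ] Lp X 2 (volume.restrict (Ioi (0 : ℝ))),
      ∀ z, L z =ᵐ[volume.restrict (Ioi 0)] fun t => T.op t (C z) := by
  let L₀ : X →ₗ[ℂ] Lp X 2 (volume.restrict (Ioi (0 : ℝ))) :=
    { toFun := fun z => (hL z).toLp _
      map_add' := fun z w => by
        rw [← MemLp.toLp_add]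
        exact MemLp.toLp_congr _ _ (Eventually.of_forall fun t => by simp)
      map_smul' := fun c z => by
        rw [RingHom.id_apply, ← MemLp.toLp_const_smul]
        exact MemLp.toLp_congr _ _ (Eventually.of_forall fun t => by simp) }
  have hL₀ : ∀ z, L₀ z =ᵐ[volume.restrict (Ioi 0)] fun t => T.op t (C z) :=
    fun z => (hL z).coeFn_toLp
  refine ⟨ContinuousLinearMap.ofSeqClosedGraph (g := L₀) fun u x y hu hy => ?_, hL₀⟩
  obtain ⟨n, hn, hlim⟩ := (tendstoInMeasure_of_tendsto_Lp hy).exists_seq_tendsto_ae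
  refine Lp.ext ?_
  have hall : ∀ᵐ t ∂(volume.restrict (Ioi (0 : ℝ))), ∀ k, L₀ (u k) t = T.op t (C (u k)) :=
    ae_all_iff.2 fun k => hL₀ (u k)
  filter_upwards [hlim, hall, hL₀ x] with t h1 h2 h3
  rw [h3]
  refine tendsto_nhds_unique h1 ?_
  have h4 : Tendsto (fun k => T.op t (C (u (n k)))) atTop (𝓝 (T.op t (C x))) :=
    (((T.op t).comp C).continuous.tendsto x).comp (hu.comp hn.tendsto_atTop)
  exact h4.congr fun k => (h2 (n k)).symm

/-- If all orbits `T(·) C z` are square integrable, then the Gramian is a bounded nonnegative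
solution of the Lyapunov equation. -/
theorem exists_isLyapunovForm {C : X →L[ℂ] X}
    (hC : ∀ t : ℝ, 0 ≤ t → ∀ x, T.op t (C x) = C (T.op t x)) (hd : DenseRange C)
    (hL : ∀ z, MemLp (fun t : ℝ => T.op t (C z)) 2 (volume.restrict (Ioi 0))) :
    ∃ G : X →L[ℂ] X →L⋆[ℂ] ℂ, T.IsLyapunovForm (innerForm C) G ∧
      ∀ z, 0 ≤ (G z z).re ∧ (G z z).im = 0 := by
  obtain ⟨L, hLz⟩ := T.exists_orbit_Lp hL
  have hint : ∀ z w, IntegrableOn (fun t => (inner ℂ (T.op t (C w)) (T.op t (C z)) : ℂ)) (Ioi 0) :=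
    fun z w => (hL w).integrable_inner_complex (hL z)
  have hG : ∀ z w, innerForm L z w =
      ∫ t in Ioi (0 : ℝ), (inner ℂ (T.op t (C w)) (T.op t (C z)) : ℂ) := by
    intro z w
    rw [innerForm_apply, L2.inner_def]
    refine integral_congr_ae ?_
    filter_upwards [hLz z, hLz w] with t h1 h2
    rw [h1, h2]
  refine ⟨innerForm L, fun a b => ?_, fun z => ?_⟩
  · set z := T.resPow 1 1 a with hz
    set w := T.resPow 1 1 b with hw
    have hstab := T.tendsto_zero_of_denseRange hd fun z => T.tendsto_zero_of_memLp (hL z)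
    rw [hG, hG, ← integral_add (hint _ _) (hint _ _)]
    have h1 := intervalIntegral_tendsto_integral_Ioi 0 ((hint (z - a) w).add (hint z (w - b)))
      tendsto_id
    have h2 : Tendsto (fun t => innerForm C (T.op t z) (T.op t w) - innerForm C z w) atTop
        (𝓝 (innerForm C 0 0 - innerForm C z w)) :=
      (tendsto_sesquilinear _ (hstab z) (hstab w)).sub_const _
    rw [map_zero, zero_sub] at h2
    refine tendsto_nhds_unique h1 (h2.congr' ?_)
    filter_upwards [eventually_ge_atTop 0] with t ht
    rw [← T.integral_sesquilinear_orbit _ (T.resPow_one_mem_generator_graph a)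
      (T.resPow_one_mem_generator_graph b) ht]
    refine intervalIntegral.integral_congr fun s hs => ?_
    rw [uIcc_of_le ht] at hs
    simp only [Pi.add_apply, innerForm_apply, hC s hs.1, ← hz, ← hw]
  · rw [innerForm_apply, inner_self_eq_norm_sq_to_K]
    have h1 : (RCLike.ofReal ‖L z‖ : ℂ) ^ 2 = ((‖L z‖ ^ 2 : ℝ) : ℂ) := by
      push_cast
      rfl
    rw [h1, Complex.ofReal_re, Complex.ofReal_im]
    exact ⟨by positivity, rfl⟩

end BoundedC0Semigroup

/-! ### Transport to the fractional domain -/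

namespace BoundedC0Semigroup

variable {X : Type*} [NormedAddCommGroup X] [InnerProductSpace ℂ X] [CompleteSpace X]
  (T : BoundedC0Semigroup X)

theorem resPow_mem_generator_graph (β : ℝ) (a : X) :
    (T.resPow β 1 (T.resPow 1 1 a), T.resPow β 1 (T.resPow 1 1 a - a)) ∈ T.generator.graph :=
  T.map_mem_generator_graph (fun _ ht x => T.op_resPow ht β 1 x)
    (T.resPow_one_mem_generator_graph a)

/-- Under the isomorphism `E = (1 - A)^{-β}` of `X` with `D((-A)^β)`, the domain `D((-A)^{β+1})`
corresponds to `D(A)`, and the Lyapunov equation for `P` to the one for the form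
`(z, w) ↦ ⟨P E z, E w⟩_β`, with right-hand side `-⟨E z, E w⟩`. -/
theorem lyapunovEquation_iff {β : ℝ} (hβ : 0 < β) {E : X ≃L[ℂ] T.FracDomain β hβ}
    (hE : ∀ z, T.fracIncl β hβ (E z) = T.resPow β 1 z)
    (P : T.FracDomain β hβ →L[ℂ] Antidual (T.FracDomain β hβ)) :
    T.LyapunovEquation β hβ P ↔
      ∀ a b, P (E (T.resPow 1 1 a - a)) (E (T.resPow 1 1 b)) +
        P (E (T.resPow 1 1 a)) (E (T.resPow 1 1 b - b)) =
          -innerForm (T.resPow β 1) (T.resPow 1 1 a) (T.resPow 1 1 b) := by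
  have hinj : Function.Injective (T.fracIncl β hβ) := Subtype.val_injective
  constructor
  · intro h a b
    have hdom : ∀ a, T.fracIncl β hβ (E (T.resPow 1 1 a)) ∈
        (T.fracPow (β + 1) (by positivity)).domain := fun a =>
      (T.mem_fracPow_add_one_domain_iff hβ _ _).2 ⟨a, (hE _).symm⟩
    have hgr : ∀ a, (T.fracIncl β hβ (E (T.resPow 1 1 a)),
        T.fracIncl β hβ (E (T.resPow 1 1 a - a))) ∈ T.generator.graph := fun a => by
      rw [hE, hE]
      exact T.resPow_mem_generator_graph β a
    rw [h _ _ _ _ (hdom a) (hdom b) (hgr a) (hgr b), innerForm_apply, hE, hE]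
  · intro h x y u v hx hy hu hv
    have key : ∀ x u : T.FracDomain β hβ,
        T.fracIncl β hβ x ∈ (T.fracPow (β + 1) (by positivity)).domain →
        (T.fracIncl β hβ x, T.fracIncl β hβ u) ∈ T.generator.graph →
        ∃ a, x = E (T.resPow 1 1 a) ∧ u = E (T.resPow 1 1 a - a) := by
      intro x u hx hu
      obtain ⟨a, ha⟩ := (T.mem_fracPow_add_one_domain_iff hβ _ _).1 hx
      refine ⟨a, hinj (by rw [hE, ha]), hinj ?_⟩
      rw [hE]
      exact LinearPMap.mem_graph_snd_inj _ hu (T.resPow_mem_generator_graph β a) ha.symm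
    obtain ⟨a, rfl, rfl⟩ := key x u hx hu
    obtain ⟨b, rfl, rfl⟩ := key y v hy hv
    rw [h, innerForm_apply, hE, hE]

end BoundedC0Semigroup

theorem proposition3p1 {X : Type*} [NormedAddCommGroup X] [InnerProductSpace ℂ X]
    [CompleteSpace X] (T : BoundedC0Semigroup X) (β : ℝ) (hβ : 0 < β) :
    -- the operator `A` maps `D((-A)^{β+1}) ⊆ D((-A)^β)` into `D((-A)^β)`
    (∀ x ∈ (T.fracPow (β + 1) (by positivity)).domain,
      x ∈ (T.fracPow β hβ).domain ∧
        ∃ u ∈ (T.fracPow β hβ).domain, (x, u) ∈ T.generator.graph) ∧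
    -- equivalence of the two conditions
    ((∀ x ∈ (T.fracPow β hβ).domain,
        MemLp (fun t : ℝ => T.op t x) 2 (volume.restrict (Ioi 0))) ↔
      ∃ P : T.FracDomain β hβ →L[ℂ] Antidual (T.FracDomain β hβ),
        T.IsLyapunovOperator β hβ P) ∧
    -- uniqueness and the formula for `P`
    (∀ P : T.FracDomain β hβ →L[ℂ] Antidual (T.FracDomain β hβ),
      T.IsLyapunovOperator β hβ P →
        (∀ Q : T.FracDomain β hβ →L[ℂ] Antidual (T.FracDomain β hβ),
          T.IsLyapunovOperator β hβ Q → Q = P) ∧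
        ∀ x y : T.FracDomain β hβ,
          IntegrableOn (fun t : ℝ => (inner ℂ (T.op t (T.fracIncl β hβ y))
            (T.op t (T.fracIncl β hβ x)) : ℂ)) (Ioi 0) ∧
          P x y = ∫ t in Ioi (0 : ℝ), (inner ℂ (T.op t (T.fracIncl β hβ y))
            (T.op t (T.fracIncl β hβ x)) : ℂ)) := by
  obtain ⟨E, hE⟩ := T.exists_equiv_graphDomain hβ
  have hE' : ∀ z, T.fracIncl β hβ (E z) = T.resPow β 1 z := hE
  have hC : ∀ t : ℝ, 0 ≤ t → ∀ x, T.op t (T.resPow β 1 x) = T.resPow β 1 (T.op t x) :=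
    fun t ht x => T.op_resPow ht β 1 x
  have hd := T.denseRange_resPow hβ
  have hform : ∀ P : T.FracDomain β hβ →L[ℂ] Antidual (T.FracDomain β hβ),
      T.IsLyapunovOperator β hβ P → ∀ x y : T.FracDomain β hβ,
        IntegrableOn (fun t : ℝ => (inner ℂ (T.op t (T.fracIncl β hβ y))
          (T.op t (T.fracIncl β hβ x)) : ℂ)) (Ioi 0) ∧
        P x y = ∫ t in Ioi (0 : ℝ), (inner ℂ (T.op t (T.fracIncl β hβ y))
          (T.op t (T.fracIncl β hβ x)) : ℂ) := by
    intro P hP x y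
    have hG : T.IsLyapunovForm (innerForm (T.resPow β 1))
        (P.bilinearComp (E : X →L[ℂ] T.FracDomain β hβ) (E : X →L[ℂ] T.FracDomain β hβ)) :=
      (T.lyapunovEquation_iff hβ hE' P).1 hP.equation
    have h := hG.eq_integral hC hd (fun z => (hP.nonneg (E z)).1) (E.symm x) (E.symm y)
    simpa [← hE'] using h
  refine ⟨fun x hx => ?_, ⟨fun hL => ?_, ?_⟩, fun P hP => ⟨fun Q hQ => ?_, hform P hP⟩⟩
  · obtain ⟨a, rfl⟩ := (T.mem_fracPow_add_one_domain_iff hβ _ _).1 hx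
    exact ⟨(T.mem_fracPow_domain_iff hβ _).2 ⟨_, rfl⟩, _,
      (T.mem_fracPow_domain_iff hβ _).2 ⟨_, rfl⟩,
      T.resPow_mem_generator_graph β a⟩
  · obtain ⟨G, hG, hG0⟩ := T.exists_isLyapunovForm hC hd fun z =>
      hL _ ((T.mem_fracPow_domain_iff hβ _).2 ⟨z, rfl⟩)
    refine ⟨G.bilinearComp (E.symm : T.FracDomain β hβ →L[ℂ] X)
      (E.symm : T.FracDomain β hβ →L[ℂ] X), fun x => hG0 (E.symm x),
      (T.lyapunovEquation_iff hβ hE' _).2 fun a b => ?_⟩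
    have h := hG a b
    simpa using h
  · rintro ⟨P, hP⟩ x hx
    obtain ⟨z, rfl⟩ := (T.mem_fracPow_domain_iff hβ x).1 hx
    have hG : T.IsLyapunovForm (innerForm (T.resPow β 1))
        (P.bilinearComp (E : X →L[ℂ] T.FracDomain β hβ) (E : X →L[ℂ] T.FracDomain β hβ)) :=
      (T.lyapunovEquation_iff hβ hE' P).1 hP.equation
    exact hG.memLp hC (fun z => (hP.nonneg (E z)).1) z
  · ext x y
    rw [(hform Q hQ x y).2, (hform P hP x y).2]
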